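/- Let $p,q\ge 0$ with $p+q=1$ and $q\neq 0$, let $t\ge 0$ and $x\in\mathbb Z$. Consider the asymmetric simple exclusion process (ASEP) on $\mathbb Z$: each particle attempts to jump one step to the right at rate $p$ and one step to the left at rate $q$, independently of the others, and an attempt succeeds exactly when the target site is vacant. For $N\ge 1$ particles started at $y_1<\dots<y_N$ in $\mathbb Z$, let $x_1(t)$ be the position of the left-most particle at time $t$. Put $\varepsilon(\xi)=p\,\xi^{-1}+q\,\xi-1$. For a nonempty finite set $S$ of positive integers let $\sigma(S)=\sum_{i\in S}i$, let $Y_S=\{y_i:i\in S\}$, and define, in the variables $\xi=(\xi_i)_{i\in S}$, $$I(x,Y_S,\xi)=\prod_{\substack{i,j\in S\\ i<j}}\frac{\xi_j-\xi_i}{p+q\,\xi_i\xi_j-\xi_i}\;\cdot\;\frac{1-\prod_{i\in S}\xi_i}{\prod_{i\in S}(1-\xi_i)}\;\cdot\;\prod_{i\in S}\Bigl(\xi_i^{\,x-y_i-1}e^{\varepsilon(\xi_i)t}\Bigr).$$ Let $\mathcal C_R$ be the circle with centre $0$ and radius $R$, positively oriented; every differential $d\xi_i$ incorporates the factor $(2\pi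 i)^{-1}$ (with $i$ here the imaginary unit), and $0^0=1$. (a) Let $R$ be so large that all the poles of the integrands lie inside $\mathcal C_R$, that is, no denominator $\xi_i$, $1-\xi_i$ or $p+q\,\xi_i\xi_j-\xi_i$ (with $1\le i<j\le N$) vanishes when all the variables have modulus at least $R$. Then $$\mathbb P(x_1(t)=x)=\sum_{\emptyset\neq S\subset\{1,\dots,N\}}\frac{p^{\,\sigma(S)-|S|}}{q^{\,\sigma(S)-|S|(|S|+1)/2}}\int_{\mathcal C_R}\!\!\cdots\int_{\mathcal C_R} I(x,Y_S,\xi)\,d^{|S|}\xi .$$ (b) Let $y_1<y_2<\cdots\to+\infty$ be an infinite sequence of integers and let $R$ satisfy the condition of (a) for every $N$. Then the series $$\sum_{S}\frac{p^{\,\sigma(S)-|S|}}{q^{\,\sigma(S)-|S|(|S|+1)/2}}\int_{\mathcal C_R}\!\!\cdots\int_{\mathcal C_R} I(x,Y_S,\xi)\,d^{|S|}\xi$$ over all nonempty finite sets $S$ of positive integers converges absolutely, and its sum is the limit as $N\to\infty$ of $\mathbb P(x_1(t)=x)$ for the $N$-particle system started at $y_1<\dots<y_N$. -/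

import Mathlib

noncomputable section

namespace ASEP

/-- Configurations of `N` particles on `ℤ`: the positions `x₁ < x₂ < ⋯ < x_N`, listed from left to
right (the particle with index `i : Fin N` is the `(i+1)`-st from the left). -/
abbrev Config (N : ℕ) : Type := {η : Fin N → ℤ // StrictMono η}

/-- Moving one particle by one step to a vacant site preserves the order of the particles. -/
theorem strictMono_update {N : ℕ} (η : Config N) (i : Fin N) (d : ℤ) (hd : d = 1 ∨ d = -1)
    (hv : ∀ j, η.1 j ≠ η.1 i + d) : StrictMono (Function.update η.1 i (η.1 i + d)) := by
  intro a b hab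
  have h1 := η.2 hab
  by_cases ha : a = i <;> by_cases hb : b = i
  · subst ha; subst hb; exact absurd hab (lt_irrefl _)
  · subst ha
    have := hv b
    simp only [Function.update_self, Function.update_of_ne hb]
    omega
  · subst hb
    have := hv a
    simp only [Function.update_self, Function.update_of_ne ha]
    omega
  · simpa only [Function.update_of_ne ha, Function.update_of_ne hb] using h1

open Classical in
/-- The exclusion rule for an attempted jump of the `i`-th particle one step to the right: the
particle moves if the target site is vacant, otherwise nothing happens. -/
def jumpRight {N : ℕ} (i : Fin N) (η : Config N) : Config N :=
  if hv : ∀ j, η.1 j ≠ η.1 i + 1 then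
    ⟨Function.update η.1 i (η.1 i + 1), strictMono_update η i 1 (Or.inl rfl) hv⟩
  else η

open Classical in
/-- The exclusion rule for an attempted jump of the `i`-th particle one step to the left. -/
def jumpLeft {N : ℕ} (i : Fin N) (η : Config N) : Config N :=
  if hv : ∀ j, η.1 j ≠ η.1 i + -1 then
    ⟨Function.update η.1 i (η.1 i + -1), strictMono_update η i (-1) (Or.inr rfl) hv⟩
  else η

/-- The Banach space `ℓ^∞` of bounded real functions of the configuration, with the supremum
norm. -/
abbrev Obs (N : ℕ) : Type := lp (fun _ : Config N => ℝ) ⊤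

/-- The operator `f ↦ f ∘ φ` on bounded functions of the configuration. -/
def pullback {N : ℕ} (φ : Config N → Config N) : Obs N →L[ℝ] Obs N :=
  LinearMap.mkContinuous
    { toFun := fun f => ⟨fun η => f (φ η), memℓp_infty ⟨‖f‖, by
        rintro _ ⟨η, rfl⟩
        exact lp.norm_apply_le_norm ENNReal.top_ne_zero f (φ η)⟩⟩
      map_add' := fun _ _ => rfl
      map_smul' := fun _ _ => rfl } 1
    (fun f => by
      rw [one_mul]
      exact lp.norm_le_of_forall_le (norm_nonneg f) fun η =>
        lp.norm_apply_le_norm ENNReal.top_ne_zero f (φ η))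

@[simp] theorem pullback_apply {N : ℕ} (φ : Config N → Config N) (f : Obs N) (η : Config N) :
    pullback φ f η = f (φ η) := rfl

/-- The generator of the `N`-particle asymmetric simple exclusion process: each particle attempts
to jump to the right at rate `p` and to the left at rate `q`, an attempt being successful exactly
when the target site is vacant. It is a bounded operator, because the total rate is at most
`N (p + q)`. -/
def generator (N : ℕ) (p q : ℝ) : Obs N →L[ℝ] Obs N :=
  ∑ i : Fin N, (p • (pullback (jumpRight i) - 1) + q • (pullback (jumpLeft i) - 1))

theorem generator_apply (N : ℕ) (p q : ℝ) (f : Obs N) (η : Config N) :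
    generator N p q f η =
      ∑ i : Fin N, (p * (f (jumpRight i η) - f η) + q * (f (jumpLeft i η) - f η)) := by
  simp only [generator, sum_apply, lp.coeFn_sum]
  exact (Finset.sum_apply η _ _).trans rfl

/-- The Markov semigroup `exp (t L)` of the process, with generator `L`: `semigroup N p q t f Y` is
the expectation of `f` at time `t` for the process started at `Y`. -/
def semigroup (N : ℕ) (p q t : ℝ) : Obs N →L[ℝ] Obs N :=
  NormedSpace.exp (t • generator N p q)

/-- The indicator function of a set of configurations. -/
def indicatorFn {N : ℕ} (A : Set (Config N)) : Obs N :=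
  ⟨A.indicator fun _ => (1 : ℝ), memℓp_infty ⟨1, by
    rintro _ ⟨η, rfl⟩
    by_cases h : η ∈ A <;> simp [h]⟩⟩

/-- The probability that the `N`-particle process with initial configuration `Y` is in the set `A`
at time `t`. -/
def prob {N : ℕ} (p q t : ℝ) (Y : Config N) (A : Set (Config N)) : ℝ :=
  semigroup N p q t (indicatorFn A) Y

/-- The initial configuration `y₁ < ⋯ < y_N` given by a sequence whose entries are numbered from
`1` (the entry `y 0` plays no role). -/
def initialConfig (y : ℕ → ℤ) (N : ℕ) (hy : StrictMonoOn y (Set.Icc 1 N)) : Config N :=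
  ⟨fun i => y (i + 1), fun i j hij =>
    hy ⟨by omega, by omega⟩ ⟨by omega, by omega⟩ (by have : (i : ℕ) < j := hij; omega)⟩

/-- `P(x₁(t) = x)`: the probability that the left-most of the `N ≥ 1` particles is at `x` at time
`t`. -/
def probFirst {N : ℕ} (hN : 0 < N) (p q t : ℝ) (Y : Config N) (x : ℤ) : ℝ :=
  prob p q t Y {η | η.1 ⟨0, hN⟩ = x}

/-- `ε(ξ) = p ξ⁻¹ + q ξ - 1`. -/
def eps (p q : ℝ) (ξ : ℂ) : ℂ := p * ξ⁻¹ + q * ξ - 1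

/-- The integrand
`I(x, Y, ξ) = ∏_{i<j} (ξ_j - ξ_i) / (p + q ξ_i ξ_j - ξ_i)
  · (1 - ξ_1 ⋯ ξ_n) / ((1 - ξ_1) ⋯ (1 - ξ_n)) · ∏_i ξ_i^{x - y_i - 1} e^{ε(ξ_i) t}`. -/
def integrand (p q t : ℝ) (x : ℤ) {n : ℕ} (y : Fin n → ℤ) (ξ : Fin n → ℂ) : ℂ :=
  (∏ i, ∏ j ∈ Finset.Ioi i, (ξ j - ξ i) / (p + q * ξ i * ξ j - ξ i)) *
    ((1 - ∏ i, ξ i) / ∏ i, (1 - ξ i)) *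
    ∏ i, (ξ i ^ (x - y i - 1) * Complex.exp (eps p q (ξ i) * t))

/-- The `n`-fold contour integral over the circle `C_R` with centre `0` and radius `R`, where every
differential incorporates the factor `(2πi)⁻¹`. -/
def contourIntegral {n : ℕ} (R : ℝ) (F : (Fin n → ℂ) → ℂ) : ℂ :=
  ((2 * Real.pi * Complex.I)⁻¹) ^ n * torusIntegral F 0 (fun _ => R)

/-- `Y_S = {y_i : i ∈ S}`, enumerated in increasing order of the index `i`. -/
def subConfig (y : ℕ → ℤ) (S : Finset ℕ) : Fin S.card → ℤ := fun k => y (S.orderEmbOfFin rfl k)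

/-- The coefficient `p^{σ(S) - |S|} / q^{σ(S) - |S|(|S|+1)/2}` with `σ(S) = ∑_{i ∈ S} i`. -/
def coeff (p q : ℝ) (S : Finset ℕ) : ℝ :=
  p ^ ((∑ i ∈ S, (i : ℤ)) - (S.card : ℤ)) /
    q ^ ((∑ i ∈ S, (i : ℤ)) - (S.card : ℤ) * ((S.card : ℤ) + 1) / 2)

/-- The contribution of the index set `S`: its coefficient times the integral of `I(x, Y_S, ξ)`
over `C_R`. -/
def contribution (p q t : ℝ) (x : ℤ) (y : ℕ → ℤ) (R : ℝ) (S : Finset ℕ) : ℂ :=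
  (coeff p q S : ℂ) * contourIntegral R (integrand p q t x (subConfig y S))

/-- All the poles of the integrands in at most `n` variables lie inside `C_R`: no denominator of
the integrand vanishes as long as all the variables lie on or outside `C_R`. -/
def PolesInside (p q R : ℝ) (n : ℕ) : Prop :=
  ∀ ξ : Fin n → ℂ, (∀ i, R ≤ ‖ξ i‖) →
    (∀ i, ξ i ≠ 0) ∧ (∀ i, 1 - ξ i ≠ 0) ∧ ∀ i j, i < j → (p : ℂ) + q * ξ i * ξ j - ξ i ≠ 0

end ASEP

end

noncomputable section

open MeasureTheory Set

namespace ASEP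

section

section PiMeasure

variable {ι κ α : Type*} [Fintype ι] [Fintype κ] [MeasurableSpace α]

/-- Resampling one coordinate of a product of probability measures. -/
theorem measurePreserving_update [DecidableEq ι] (μ : ι → Measure α)
    [∀ i, IsProbabilityMeasure (μ i)] (i : ι) (ν : Measure α) [IsProbabilityMeasure ν] :
    MeasurePreserving (fun x : (ι → α) × α => Function.update x.1 i x.2)
      ((Measure.pi μ).prod ν) (Measure.pi (Function.update μ i ν)) := by
  have hm : Measurable (fun x : (ι → α) × α => Function.update x.1 i x.2) := by
    refine measurable_pi_iff.2 fun j => ?_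
    by_cases h : j = i
    · subst h; simpa using measurable_snd
    · simp only [Function.update_of_ne h]
      exact (measurable_pi_apply j).comp measurable_fst
  have : ∀ j, IsProbabilityMeasure (Function.update μ i ν j) := by
    intro j
    by_cases h : j = i
    · subst h; simpa
    · simpa [Function.update_of_ne h] using inferInstanceAs (IsProbabilityMeasure (μ j))
  refine ⟨hm, (Measure.pi_eq fun s hs => ?_).symm⟩
  rw [Measure.map_apply hm (MeasurableSet.univ_pi hs)]
  have : (fun x : (ι → α) × α => Function.update x.1 i x.2) ⁻¹' (univ.pi s) =
      (univ.pi (Function.update s i univ)) ×ˢ s i := by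
    ext ⟨x, z⟩
    simp only [mem_preimage, mem_univ_pi, mem_prod]
    constructor
    · intro h
      refine ⟨fun j => ?_, by simpa using h i⟩
      by_cases hj : j = i
      · subst hj; simp
      · simpa [Function.update_of_ne hj] using h j
    · rintro ⟨h, hz⟩ j
      by_cases hj : j = i
      · subst hj; simpa
      · simpa [Function.update_of_ne hj] using h j
  rw [this, Measure.prod_prod, Measure.pi_pi, ← Finset.mul_prod_erase _ _ (Finset.mem_univ i),
    ← Finset.mul_prod_erase Finset.univ (fun j => Function.update μ i ν j (s j)) (Finset.mem_univ i)]
  simp only [Function.update_self, measure_univ, one_mul]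
  rw [mul_comm]
  congr 1
  refine Finset.prod_congr rfl fun j hj => ?_
  rw [Function.update_of_ne (Finset.ne_of_mem_erase hj),
    Function.update_of_ne (Finset.ne_of_mem_erase hj)]

/-- An injective family of coordinates of i.i.d. random variables is again i.i.d. -/
theorem measurePreserving_comp (μ : Measure α) [IsProbabilityMeasure μ] {e : κ → ι}
    (he : Function.Injective e) :
    MeasurePreserving (fun x : ι → α => x ∘ e) (Measure.pi fun _ => μ) (Measure.pi fun _ => μ) := by
  classical
  have hm : Measurable (fun x : ι → α => x ∘ e) :=
    measurable_pi_iff.2 fun j => measurable_pi_apply (e j)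
  refine ⟨hm, (Measure.pi_eq fun s hs => ?_).symm⟩
  rw [Measure.map_apply hm (MeasurableSet.univ_pi hs)]
  have : (fun x : ι → α => x ∘ e) ⁻¹' (univ.pi s) =
      univ.pi (fun i => if h : ∃ k, e k = i then s h.choose else univ) := by
    ext x
    simp only [mem_preimage, mem_univ_pi, Function.comp]
    constructor
    · intro h i
      split_ifs with hi
      · simpa [hi.choose_spec] using h hi.choose
      · trivial
    · intro h k
      have h1 := h (e k)
      have hk : ∃ k', e k' = e k := ⟨k, rfl⟩
      rw [dif_pos hk, he hk.choose_spec] at h1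
      exact h1
  rw [this, Measure.pi_pi]
  symm
  have h2 := Finset.prod_subset (Finset.subset_univ (Finset.univ.image e))
    (f := fun i => μ (if h : ∃ k, e k = i then s h.choose else univ)) (by
      intro i _ hi
      have : ¬ ∃ k, e k = i := by simpa using hi
      simp [dif_neg this])
  rw [← h2, Finset.prod_image (fun a _ b _ h => he h)]
  refine Finset.prod_congr rfl fun k _ => ?_
  have hk : ∃ k', e k' = e k := ⟨k, rfl⟩
  rw [dif_pos hk, he hk.choose_spec]

end PiMeasure

/-- The uniform probability measure on the circle with centre `0` and radius `r`. -/
def circleMeasure (r : ℝ) : Measure ℂ :=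
  (ENNReal.ofReal (2 * Real.pi)⁻¹ • volume.restrict (Icc 0 (2 * Real.pi))).map (circleMap 0 r)

theorem measurable_circleMap (r : ℝ) : Measurable (circleMap 0 r) :=
  (continuous_circleMap 0 r).measurable

instance : IsProbabilityMeasure
    (ENNReal.ofReal (2 * Real.pi)⁻¹ • (volume : Measure ℝ).restrict (Icc 0 (2 * Real.pi))) := by
  constructor
  have h : 0 < 2 * Real.pi := by positivity
  simp only [Measure.smul_apply, MeasurableSet.univ, Measure.restrict_apply, univ_inter,
    Real.volume_Icc, sub_zero, smul_eq_mul]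
  rw [← ENNReal.ofReal_mul (by positivity), inv_mul_cancel₀ h.ne', ENNReal.ofReal_one]

instance (r : ℝ) : IsProbabilityMeasure (circleMeasure r) :=
  Measure.isProbabilityMeasure_map (measurable_circleMap r).aemeasurable

theorem ae_circleMeasure {r : ℝ} (hr : 0 ≤ r) : ∀ᵐ z ∂circleMeasure r, ‖z‖ = r := by
  rw [circleMeasure, ae_map_iff (measurable_circleMap r).aemeasurable
    (measurableSet_eq_fun measurable_norm measurable_const)]
  exact Filter.Eventually.of_forall fun θ => by simp [abs_of_nonneg hr]

theorem integral_circleMeasure {r : ℝ} (hr : 0 ≤ r) {g : ℂ → ℂ}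
    (hg : ContinuousOn g (Metric.sphere 0 r)) :
    ∫ z, g z ∂circleMeasure r = Real.circleAverage g 0 r := by
  have hres : (circleMeasure r).restrict (Metric.sphere 0 r) = circleMeasure r := by
    refine Measure.restrict_eq_self_of_ae_mem ?_
    filter_upwards [ae_circleMeasure hr] with z hz using by simpa using hz
  have hm : AEStronglyMeasurable g (circleMeasure r) := by
    rw [← hres]
    exact hg.aestronglyMeasurable Metric.isClosed_sphere.measurableSet
  rw [circleMeasure] at hm ⊢
  rw [integral_map (measurable_circleMap r).aemeasurable hm, integral_smul_measure,
    Real.circleAverage_def, intervalIntegral.integral_of_le (by positivity),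
    integral_Icc_eq_integral_Ioc, ENNReal.toReal_ofReal (by positivity)]

variable {ι : Type*}

/-- The distinguished boundary of a polydisc. -/
def torus (r : ι → ℝ) : Set (ι → ℂ) := {ξ | ∀ i, ‖ξ i‖ = r i}

theorem isCompact_torus (r : ι → ℝ) : IsCompact (torus r) := by
  have : torus r = univ.pi fun i => Metric.sphere (0 : ℂ) (r i) := by
    ext ξ; simp [torus]
  rw [this]
  exact isCompact_univ_pi fun i => isCompact_sphere 0 (r i)

/-- `F` is complex differentiable wherever all the variables have modulus at least `R`. -/
def HolOutside (R : ℝ) (F : (ι → ℂ) → ℂ) : Prop :=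
  ∀ ξ : ι → ℂ, (∀ i, R ≤ ‖ξ i‖) → DifferentiableAt ℂ F ξ

theorem HolOutside.continuousOn {R : ℝ} {F : (ι → ℂ) → ℂ} (hF : HolOutside R F) {r : ι → ℝ}
    (hr : ∀ i, R ≤ r i) : ContinuousOn F (torus r) := fun ξ hξ =>
  (hF ξ fun i => (hr i).trans (hξ i).ge).continuousAt.continuousWithinAt

variable [Fintype ι]

/-- The product of the uniform probability measures on the circles of radii `r i`. -/
def torusMeasure (r : ι → ℝ) : Measure (ι → ℂ) := Measure.pi fun i => circleMeasure (r i)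

instance (r : ι → ℝ) : IsProbabilityMeasure (torusMeasure r) := by
  unfold torusMeasure; infer_instance

theorem ae_torusMeasure {r : ι → ℝ} (hr : ∀ i, 0 ≤ r i) :
    ∀ᵐ ξ ∂torusMeasure r, ∀ i, ‖ξ i‖ = r i :=
  Filter.eventually_all.2 fun i =>
    (Measure.tendsto_eval_ae_ae (μ := fun j => circleMeasure (r j)) (i := i)).eventually
      (ae_circleMeasure (hr i))

theorem restrict_torusMeasure {r : ι → ℝ} (hr : ∀ i, 0 ≤ r i) :
    (torusMeasure r).restrict (torus r) = torusMeasure r :=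
  Measure.restrict_eq_self_of_ae_mem (ae_torusMeasure hr)

theorem integrable_torusMeasure {r : ι → ℝ} (hr : ∀ i, 0 ≤ r i) {F : (ι → ℂ) → ℂ}
    (hF : ContinuousOn F (torus r)) : Integrable F (torusMeasure r) := by
  rw [← restrict_torusMeasure hr]
  exact hF.integrableOn_compact (isCompact_torus r)

theorem integral_torusMeasure_update [DecidableEq ι] {r : ι → ℝ} (i : ι) {ρ : ℝ}
    (hr : ∀ j, 0 ≤ Function.update r i ρ j) {F : (ι → ℂ) → ℂ}
    (hF : ContinuousOn F (torus (Function.update r i ρ))) :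
    ∫ ξ, F ξ ∂torusMeasure (Function.update r i ρ) =
      ∫ ξ, ∫ z, F (Function.update ξ i z) ∂circleMeasure ρ ∂torusMeasure r := by
  have h := measurePreserving_update (fun j => circleMeasure (r j)) i (circleMeasure ρ)
  have he : (Measure.pi (Function.update (fun j => circleMeasure (r j)) i (circleMeasure ρ))) =
      torusMeasure (Function.update r i ρ) := by
    unfold torusMeasure
    congr 1
    ext1 j
    by_cases hj : j = i
    · subst hj; simp
    · simp [Function.update_of_ne hj]
  rw [he] at h
  have hi := integrable_torusMeasure hr hF
  rw [← h.map_eq, integral_map h.measurable.aemeasurable (by rw [h.map_eq]; exact hi.1)]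
  exact integral_prod _ (h.integrable_comp_of_integrable hi)

theorem circleAverage_eq_of_differentiable {r r' : ℝ} (h0 : 0 < r) (hr : r ≤ r') {g : ℂ → ℂ}
    (hg : ∀ z, r ≤ ‖z‖ → DifferentiableAt ℂ g z) :
    Real.circleAverage g 0 r' = Real.circleAverage g 0 r := by
  rw [Real.circleAverage_eq_circleIntegral (h0.trans_le hr).ne',
    Real.circleAverage_eq_circleIntegral h0.ne']
  congr 1
  refine Complex.circleIntegral_sub_center_inv_smul_eq_of_differentiable_on_annulus_off_countable
    h0 hr countable_empty (fun z hz => (hg z ?_).continuousAt.continuousWithinAt) fun z hz => hg z ?_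
  · simpa using hz.2
  · have := hz.1.2
    simp only [Metric.mem_closedBall, dist_zero_right, not_le] at this
    exact this.le

theorem integral_torusMeasure_update_eq [DecidableEq ι] {R : ℝ} {F : (ι → ℂ) → ℂ}
    (hF : HolOutside R F) {r : ι → ℝ} (h0 : ∀ i, 0 < r i) (hr : ∀ i, R ≤ r i) (i : ι) {ρ ρ' : ℝ}
    (hR0 : 0 < ρ) (hρR : R ≤ ρ) (hρ : ρ ≤ ρ') :
    ∫ ξ, F ξ ∂torusMeasure (Function.update r i ρ') =
      ∫ ξ, F ξ ∂torusMeasure (Function.update r i ρ) := by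
  have key : ∀ (P : ℝ → Prop) (ρ : ℝ), (∀ j, P (r j)) → P ρ → ∀ j, P (Function.update r i ρ j) := by
    intro P ρ h1 h2 j
    by_cases hj : j = i
    · subst hj; simpa
    · simpa [Function.update_of_ne hj] using h1 j
  have hd : ∀ ξ ∈ torus r, ∀ z, ρ ≤ ‖z‖ →
      DifferentiableAt ℂ (fun z => F (Function.update ξ i z)) z := by
    intro ξ hξ z hz
    refine DifferentiableAt.comp z (hF _ fun j => ?_) (hasDerivAt_update ξ i z).differentiableAt
    by_cases hj : j = i
    · subst hj; simpa using hρR.trans hz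
    · simpa [Function.update_of_ne hj, hξ j] using hr j
  rw [integral_torusMeasure_update i (key _ _ (fun j => (h0 j).le) (hR0.trans_le hρ).le)
      (hF.continuousOn (key _ _ hr (hρR.trans hρ))),
    integral_torusMeasure_update i (key _ _ (fun j => (h0 j).le) hR0.le)
      (hF.continuousOn (key _ _ hr hρR))]
  refine integral_congr_ae ?_
  filter_upwards [ae_torusMeasure fun i => (h0 i).le] with ξ hξ
  rw [integral_circleMeasure (hR0.trans_le hρ).le, integral_circleMeasure hR0.le,
    circleAverage_eq_of_differentiable hR0 hρ (hd ξ hξ)]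
  · exact fun z hz => (hd ξ hξ z (by simp at hz; exact hz.ge)).continuousAt.continuousWithinAt
  · exact fun z hz => (hd ξ hξ z (by simp at hz; rw [hz]; exact hρ)).continuousAt.continuousWithinAt

/-- The integral of a function holomorphic outside does not depend on the radii. -/
theorem integral_torusMeasure_eq {R : ℝ} {F : (ι → ℂ) → ℂ} (hF : HolOutside R F) {r r' : ι → ℝ}
    (h0 : ∀ i, 0 < r i) (hr : ∀ i, R ≤ r i) (hr' : ∀ i, r i ≤ r' i) :
    ∫ ξ, F ξ ∂torusMeasure r' = ∫ ξ, F ξ ∂torusMeasure r := by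
  classical
  have : ∀ s : Finset ι, ∫ ξ, F ξ ∂torusMeasure (s.piecewise r' r) = ∫ ξ, F ξ ∂torusMeasure r := by
    intro s
    induction s using Finset.induction_on with
    | empty => simp
    | insert i s hi ih =>
      rw [← ih, Finset.piecewise_insert]
      have h1 : ∀ j, r j ≤ s.piecewise r' r j := fun j => by
        by_cases hj : j ∈ s <;> simp [hj, hr']
      conv_rhs => rw [← Function.update_eq_self i (s.piecewise r' r)]
      refine integral_torusMeasure_update_eq hF (fun j => (h0 j).trans_le (h1 j))
        (fun j => (hr j).trans (h1 j)) i ((h0 i).trans_le (h1 i)) ((hr i).trans (h1 i)) ?_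
      simp [hi, hr']
  simpa using this Finset.univ

theorem norm_integral_torusMeasure_le {r : ι → ℝ} (hr : ∀ i, 0 ≤ r i) {F : (ι → ℂ) → ℂ} {C : ℝ}
    (hC : ∀ ξ ∈ torus r, ‖F ξ‖ ≤ C) : ‖∫ ξ, F ξ ∂torusMeasure r‖ ≤ C := by
  refine (norm_integral_le_of_norm_le_const (C := C) ?_).trans (by simp)
  filter_upwards [ae_torusMeasure hr] with ξ hξ using hC ξ hξ

/-- A function that is holomorphic outside and decays in one of the variables integrates to
zero. -/
theorem integral_torusMeasure_eq_zero {R : ℝ} {F : (ι → ℂ) → ℂ} (hF : HolOutside R F) {r : ι → ℝ}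
    (h0 : ∀ i, 0 < r i) (hr : ∀ i, R ≤ r i) (i : ι) (C : ℝ)
    (hC : ∀ ξ : ι → ℂ, (∀ j, j ≠ i → ‖ξ j‖ = r j) → r i ≤ ‖ξ i‖ → ‖F ξ‖ ≤ C / ‖ξ i‖) :
    ∫ ξ, F ξ ∂torusMeasure r = 0 := by
  classical
  have hb : ∀ ρ, r i ≤ ρ → ‖∫ ξ, F ξ ∂torusMeasure r‖ ≤ C / ρ := by
    intro ρ hρ
    have h1 := integral_torusMeasure_update_eq hF h0 hr i (h0 i) (hr i) hρ
    rw [Function.update_eq_self] at h1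
    rw [← h1]
    refine norm_integral_torusMeasure_le ?_ ?_
    · intro j
      by_cases hj : j = i
      · subst hj; simpa using (h0 j).le.trans hρ
      · simpa [Function.update_of_ne hj] using (h0 j).le
    · intro ξ hξ
      have hi : ‖ξ i‖ = ρ := by simpa using hξ i
      have := hC ξ (fun j hj => by simpa [Function.update_of_ne hj] using hξ j) (hi ▸ hρ)
      rwa [hi] at this
  have hlim : Filter.Tendsto (fun ρ : ℝ => C / ρ) Filter.atTop (nhds 0) :=
    Filter.Tendsto.div_atTop tendsto_const_nhds Filter.tendsto_id
  have := ge_of_tendsto hlim (Filter.eventually_atTop.2 ⟨r i, hb⟩)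
  simpa using this

/-- The normalized contour integral is an average over the torus. -/
theorem contourIntegral_eq_integral {n : ℕ} {R : ℝ} (hR : 0 ≤ R) {F : (Fin n → ℂ) → ℂ}
    (hF : ContinuousOn F (torus fun _ => R)) :
    contourIntegral R F = ∫ ξ, F ξ * ∏ i, ξ i ∂torusMeasure fun _ : Fin n => R := by
  have hcont : ContinuousOn (fun ξ : Fin n → ℂ => F ξ * ∏ i, ξ i) (torus fun _ => R) :=
    hF.mul (Continuous.continuousOn (by fun_prop))
  have hpi : torusMeasure (fun _ : Fin n => R) =
      (Measure.pi fun _ : Fin n =>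
        ENNReal.ofReal (2 * Real.pi)⁻¹ • (volume : Measure ℝ).restrict (Icc 0 (2 * Real.pi))).map
        (fun θ i => circleMap 0 R (θ i)) :=
    haveI : ∀ i : Fin n, SigmaFinite (Measure.map ((fun _ => circleMap 0 R) i)
        ((fun _ => ENNReal.ofReal (2 * Real.pi)⁻¹ •
          (volume : Measure ℝ).restrict (Icc 0 (2 * Real.pi))) i)) := fun i =>
      inferInstanceAs (SigmaFinite (circleMeasure R))
    (Measure.pi_map_pi (f := fun _ : Fin n => circleMap 0 R)
      (fun _ => (measurable_circleMap R).aemeasurable)).symm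
  have hsm : (Measure.pi fun _ : Fin n =>
        ENNReal.ofReal (2 * Real.pi)⁻¹ • (volume : Measure ℝ).restrict (Icc 0 (2 * Real.pi))) =
      ENNReal.ofReal (2 * Real.pi)⁻¹ ^ n •
        (volume : Measure (Fin n → ℝ)).restrict (Icc 0 fun _ => 2 * Real.pi) := by
    refine Measure.pi_eq fun s hs => ?_
    have : Icc (0 : Fin n → ℝ) (fun _ => 2 * Real.pi) = univ.pi fun _ => Icc 0 (2 * Real.pi) := by
      rw [pi_univ_Icc]; rfl
    rw [this, volume_pi, Measure.restrict_pi_pi]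
    simp only [Measure.smul_apply, Measure.pi_pi, smul_eq_mul, Finset.prod_mul_distrib,
      Finset.prod_const, Finset.card_univ, Fintype.card_fin]
  have hmeas : Measurable fun (θ : Fin n → ℝ) (i : Fin n) => circleMap 0 R (θ i) :=
    measurable_pi_iff.2 fun i => (measurable_circleMap R).comp (measurable_pi_apply i)
  have hint := (integrable_torusMeasure (fun _ => hR) hcont).1
  rw [hpi] at hint ⊢
  rw [integral_map hmeas.aemeasurable hint, hsm, integral_smul_measure, contourIntegral,
    torusIntegral, ENNReal.toReal_pow, ENNReal.toReal_ofReal (by positivity)]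
  rw [← integral_const_mul, ← integral_smul]
  refine integral_congr_ae (Filter.Eventually.of_forall fun θ => ?_)
  have ht : torusMap (0 : Fin n → ℂ) (fun _ => R) θ = fun i => circleMap 0 R (θ i) := by
    ext i; simp [torusMap, circleMap]
  simp only [ht, smul_eq_mul, Complex.real_smul]
  simp only [circleMap_zero, Finset.prod_mul_distrib, Finset.prod_const, Finset.card_univ,
    Fintype.card_fin, mul_inv, mul_pow]
  push_cast
  have hI : (Complex.I)⁻¹ ^ n * Complex.I ^ n = 1 := by
    rw [← mul_pow, inv_mul_cancel₀ Complex.I_ne_zero, one_pow]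
  linear_combination (((2 : ℂ)⁻¹ * (Real.pi : ℂ)⁻¹) ^ n * (R : ℂ) ^ n *
    (∏ i, Complex.exp (θ i * Complex.I)) * F (fun i => R * Complex.exp (θ i * Complex.I))) * hI

end

section

theorem integral_torusMeasure_comp {ι κ : Type*} [Fintype ι] [Fintype κ] {R : ℝ} (hR : 0 ≤ R)
    {e : κ → ι} (he : Function.Injective e) {F : (κ → ℂ) → ℂ}
    (hF : ContinuousOn F (torus fun _ => R)) :
    ∫ ξ, F (ξ ∘ e) ∂torusMeasure (fun _ : ι => R) = ∫ ξ, F ξ ∂torusMeasure (fun _ : κ => R) := by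
  have h := measurePreserving_comp (circleMeasure R) he
  have hi := (integrable_torusMeasure (fun _ => hR) hF).1
  unfold torusMeasure at hi ⊢
  rw [← h.map_eq, integral_map h.measurable.aemeasurable (by rw [h.map_eq]; exact hi)]

theorem hasDerivAt_integral_mul_exp {ι : Type*} [Fintype ι] {r : ι → ℝ} (hr : ∀ i, 0 ≤ r i)
    {A E : (ι → ℂ) → ℂ} (hA : ContinuousOn A (torus r)) (hE : ContinuousOn E (torus r)) (t : ℝ) :
    HasDerivAt (fun t : ℝ => ∫ ξ, A ξ * Complex.exp (E ξ * t) ∂torusMeasure r)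
      (∫ ξ, E ξ * (A ξ * Complex.exp (E ξ * t)) ∂torusMeasure r) t := by
  obtain ⟨CA, hCA⟩ := (isCompact_torus r).exists_bound_of_continuousOn hA
  obtain ⟨CE, hCE⟩ := (isCompact_torus r).exists_bound_of_continuousOn hE
  have hc : ∀ t : ℝ, ContinuousOn (fun ξ => A ξ * Complex.exp (E ξ * t)) (torus r) := fun t =>
    hA.mul (Complex.continuous_exp.comp_continuousOn (hE.mul continuousOn_const))
  refine (hasDerivAt_integral_of_dominated_loc_of_deriv_le
    (F := fun (t : ℝ) ξ => A ξ * Complex.exp (E ξ * t))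
    (F' := fun (t : ℝ) ξ => E ξ * (A ξ * Complex.exp (E ξ * t)))
    (bound := fun _ => CE * (CA * Real.exp (CE * (|t| + 1)))) (Metric.ball_mem_nhds t one_pos)
    (Filter.Eventually.of_forall fun t => (integrable_torusMeasure hr (hc t)).1)
    (integrable_torusMeasure hr (hc t)) (integrable_torusMeasure hr (hE.mul (hc t))).1 ?_
    (integrable_const _) ?_).2
  · filter_upwards [ae_torusMeasure hr] with ξ hξ s hs
    have h1 := hCA ξ hξ
    have h2 := hCE ξ hξ
    have h3 : |s| ≤ |t| + 1 := by
      have := abs_sub_abs_le_abs_sub s t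
      rw [Metric.mem_ball, Real.dist_eq] at hs
      linarith
    have h4 : ‖Complex.exp (E ξ * s)‖ ≤ Real.exp (CE * (|t| + 1)) := by
      rw [Complex.norm_exp]
      refine Real.exp_le_exp.2 (((Complex.re_le_norm _).trans ?_))
      rw [norm_mul, Complex.norm_real, Real.norm_eq_abs]
      exact mul_le_mul h2 h3 (abs_nonneg _) ((norm_nonneg _).trans h2)
    rw [norm_mul, norm_mul]
    have := (norm_nonneg _).trans h1
    have := (norm_nonneg _).trans h2
    gcongr
  · refine Filter.Eventually.of_forall fun ξ s _ => ?_
    have h := (((Complex.ofRealCLM.hasDerivAt (x := s)).const_mul (E ξ)).cexp).const_mul (A ξ)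
    refine h.congr_deriv ?_
    simp
    ring

/-- The standing assumptions on the parameters, with a radius so large that the denominators of the
integrand are bounded below. -/
structure IsLarge (p q R : ℝ) : Prop where
  p_nonneg : 0 ≤ p
  q_pos : 0 < q
  add_eq : p + q = 1
  large : 4 ≤ q * R

namespace IsLarge

variable {p q R : ℝ}

theorem q_le_one (h : IsLarge p q R) : q ≤ 1 := by linarith [h.p_nonneg, h.add_eq]

theorem four_le (h : IsLarge p q R) : 4 ≤ R := by
  have h1 := h.large
  have h2 := h.q_le_one
  have h3 := h.q_pos
  by_contra! h4
  nlinarith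

theorem pos (h : IsLarge p q R) : 0 < R := by linarith [h.four_le]

theorem ne_zero (h : IsLarge p q R) {z : ℂ} (hz : R ≤ ‖z‖) : z ≠ 0 := by
  rintro rfl
  rw [norm_zero] at hz
  linarith [h.pos]

theorem norm_div_two_le (h : IsLarge p q R) {z : ℂ} (hz : R ≤ ‖z‖) : ‖z‖ / 2 ≤ ‖1 - z‖ := by
  have h1 : ‖z‖ - ‖(1 : ℂ)‖ ≤ ‖1 - z‖ := by
    rw [norm_sub_rev]; exact norm_sub_norm_le z 1
  rw [norm_one] at h1
  linarith [h.four_le]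

theorem one_sub_ne_zero (h : IsLarge p q R) {z : ℂ} (hz : R ≤ ‖z‖) : 1 - z ≠ 0 := by
  have h1 := h.norm_div_two_le hz
  have h2 := h.four_le
  intro h3
  rw [h3, norm_zero] at h1
  linarith

theorem le_norm_den (h : IsLarge p q R) {z w : ℂ} (hz : R ≤ ‖z‖) (hw : R ≤ ‖w‖) :
    q / 2 * (‖z‖ * ‖w‖) ≤ ‖(p : ℂ) + q * z * w - z‖ := by
  have h1 : ‖(q : ℂ) * z * w‖ ≤ ‖(p : ℂ) + q * z * w - z‖ + ‖(p : ℂ)‖ + ‖z‖ := by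
    have : (q : ℂ) * z * w = ((p : ℂ) + q * z * w - z) - p + z := by ring
    calc ‖(q : ℂ) * z * w‖ = ‖((p : ℂ) + q * z * w - z) - p + z‖ := by rw [← this]
      _ ≤ _ := (norm_add_le _ _).trans (add_le_add_left (norm_sub_le _ _) _)
  rw [norm_mul, norm_mul, Complex.norm_real, Complex.norm_real, Real.norm_of_nonneg h.q_pos.le,
    Real.norm_of_nonneg h.p_nonneg] at h1
  have h2 : 4 ≤ q * ‖w‖ := h.large.trans (mul_le_mul_of_nonneg_left hw h.q_pos.le)
  have h3 := h.four_le.trans hz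
  have h4 : p ≤ 1 := by linarith [h.q_pos, h.add_eq]
  nlinarith

theorem den_ne_zero (h : IsLarge p q R) {z w : ℂ} (hz : R ≤ ‖z‖) (hw : R ≤ ‖w‖) :
    (p : ℂ) + q * z * w - z ≠ 0 := by
  have h1 := h.le_norm_den hz hw
  have : 0 < q / 2 * (‖z‖ * ‖w‖) := by
    have := h.q_pos
    have := h.pos.trans_le hz
    have := h.pos.trans_le hw
    positivity
  exact norm_pos_iff.1 (this.trans_le h1)

end IsLarge

/-- The two-particle factor `(w - z) / (p + q z w - z)`. -/
def scatter (p q : ℝ) (z w : ℂ) : ℂ := (w - z) / (p + q * z * w - z)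

theorem IsLarge.norm_scatter_le {p q R : ℝ} (h : IsLarge p q R) {z w : ℂ} (hz : R ≤ ‖z‖)
    (hw : R ≤ ‖w‖) : ‖scatter p q z w‖ ≤ 1 := by
  have h1 := h.le_norm_den hz hw
  rw [scatter, norm_div]
  refine div_le_one_of_le₀ (le_trans ((norm_sub_le _ _).trans ?_) h1) (norm_nonneg _)
  have h2 : 4 ≤ q * ‖w‖ := h.large.trans (mul_le_mul_of_nonneg_left hw h.q_pos.le)
  have h3 : 4 ≤ q * ‖z‖ := h.large.trans (mul_le_mul_of_nonneg_left hz h.q_pos.le)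
  nlinarith [norm_nonneg z, norm_nonneg w]

/-- The one-particle factor `ξ^m / (1 - ξ) · e^{ε(ξ) t}`. -/
def single (p q t : ℝ) (m : ℤ) (z : ℂ) : ℂ := z ^ m / (1 - z) * Complex.exp (eps p q z * t)

theorem differentiableAt_eps {p q : ℝ} {z : ℂ} (hz : z ≠ 0) :
    DifferentiableAt ℂ (eps p q) z := by
  unfold eps
  fun_prop (disch := assumption)

theorem IsLarge.differentiableAt_single {p q R : ℝ} (hR : IsLarge p q R) (t : ℝ) (m : ℤ) {z : ℂ}
    (hz : R ≤ ‖z‖) : DifferentiableAt ℂ (single p q t m) z := by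
  have h0 := hR.ne_zero hz
  have h1 := hR.one_sub_ne_zero hz
  unfold single
  refine ((DifferentiableAt.zpow differentiableAt_id (Or.inl h0)).div (by fun_prop) h1).mul ?_
  exact ((differentiableAt_eps h0).mul_const _).cexp

section

variable {ι : Type*} [Fintype ι]

theorem IsLarge.holOutside_scatter {p q R : ℝ} (hR : IsLarge p q R) (i j : ι) :
    HolOutside R fun ξ : ι → ℂ => scatter p q (ξ i) (ξ j) := by
  intro ξ hξ
  have := hR.den_ne_zero (hξ i) (hξ j)
  unfold scatter
  fun_prop (disch := assumption)

theorem IsLarge.holOutside_single {p q R : ℝ} (hR : IsLarge p q R) (t : ℝ) (m : ℤ) (i : ι) :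
    HolOutside R fun ξ : ι → ℂ => single p q t m (ξ i) := fun ξ hξ =>
  DifferentiableAt.comp (f := fun ξ : ι → ℂ => ξ i) ξ (hR.differentiableAt_single t m (hξ i))
    (differentiableAt_apply i ξ)

theorem HolOutside.mul {R : ℝ} {F G : (ι → ℂ) → ℂ} (hF : HolOutside R F) (hG : HolOutside R G) :
    HolOutside R fun ξ => F ξ * G ξ := fun ξ hξ => (hF ξ hξ).mul (hG ξ hξ)

theorem HolOutside.prod {R : ℝ} {κ : Type*} {s : Finset κ} {F : κ → (ι → ℂ) → ℂ}
    (hF : ∀ k ∈ s, HolOutside R (F k)) : HolOutside R fun ξ => ∏ k ∈ s, F k ξ := by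
  classical
  induction s using Finset.induction_on with
  | empty => exact fun ξ _ => by simp
  | insert k s hk ih =>
    simp only [Finset.prod_insert hk]
    exact (hF k (by simp)).mul (ih fun j hj => hF j (by simp [hj]))

end

variable {ι : Type*} [LinearOrder ι]

/-- The increasing pairs of elements of `S`. -/
def incPairs (S : Finset ι) : Finset (ι × ι) := {z ∈ S ×ˢ S | z.1 < z.2}

@[simp] theorem mem_incPairs {S : Finset ι} {z : ι × ι} :
    z ∈ incPairs S ↔ (z.1 ∈ S ∧ z.2 ∈ S) ∧ z.1 < z.2 := by simp [incPairs]

/-- The integrand attached to the set `S` of particles in the formula for `P(x₁(t) ≥ x)`, with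
respect to the normalized measure on the torus. -/
def wave (p q t : ℝ) (x : ℤ) (Y : ι → ℤ) (S : Finset ι) (ξ : ι → ℂ) : ℂ :=
  (∏ z ∈ incPairs S, scatter p q (ξ z.1) (ξ z.2)) * ∏ i ∈ S, single p q t (x - Y i) (ξ i)

theorem wave_congr {p q t : ℝ} {x : ℤ} {Y Y' : ι → ℤ} {S : Finset ι} (h : ∀ i ∈ S, Y i = Y' i)
    (ξ : ι → ℂ) : wave p q t x Y S ξ = wave p q t x Y' S ξ := by
  unfold wave
  congr 1
  exact Finset.prod_congr rfl fun i hi => by rw [h i hi]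

theorem wave_eq_mul_exp (p q t : ℝ) (x : ℤ) (Y : ι → ℤ) (S : Finset ι) (ξ : ι → ℂ) :
    wave p q t x Y S ξ = wave p q 0 x Y S ξ * Complex.exp ((∑ i ∈ S, eps p q (ξ i)) * t) := by
  simp only [wave, single, Complex.ofReal_zero, mul_zero, Complex.exp_zero, mul_one,
    Finset.prod_mul_distrib, Finset.sum_mul, Complex.exp_sum, mul_assoc]

/-- Changing one of the positions multiplies the integrand by a power of the variable. -/
theorem wave_update {p q t : ℝ} {x : ℤ} {Y : ι → ℤ} {S : Finset ι} {ξ : ι → ℂ} {i : ι}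
    (hi : i ∈ S) (h0 : ξ i ≠ 0) (d : ℤ) :
    wave p q t x (Function.update Y i (Y i + d)) S ξ = ξ i ^ (-d) * wave p q t x Y S ξ := by
  unfold wave
  rw [← Finset.mul_prod_erase S _ hi, ← Finset.mul_prod_erase S _ hi]
  have : ∏ j ∈ S.erase i, single p q t (x - Function.update Y i (Y i + d) j) (ξ j) =
      ∏ j ∈ S.erase i, single p q t (x - Y j) (ξ j) :=
    Finset.prod_congr rfl fun j hj => by rw [Function.update_of_ne (Finset.ne_of_mem_erase hj)]
  rw [this, Function.update_self]
  have : single p q t (x - (Y i + d)) (ξ i) = ξ i ^ (-d) * single p q t (x - Y i) (ξ i) := by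
    unfold single
    rw [show x - (Y i + d) = -d + (x - Y i) by ring, zpow_add₀ h0]
    ring
  rw [this]
  ring

theorem wave_update_of_notMem {p q t : ℝ} {x : ℤ} {Y : ι → ℤ} {S : Finset ι} {ξ : ι → ℂ} {i : ι}
    (hi : i ∉ S) (d : ℤ) : wave p q t x (Function.update Y i d) S ξ = wave p q t x Y S ξ :=
  wave_congr (fun j hj => by rw [Function.update_of_ne (by rintro rfl; exact hi hj)]) ξ

/-- Adjacent indices. -/
structure Adjacent (i j : ι) : Prop where
  lt : i < j
  iff : ∀ k, k ≠ i → k ≠ j → (k < i ↔ k < j)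

theorem Adjacent.swap_lt {i j : ι} (h : Adjacent i j) {a b : ι} (hab : a < b)
    (hne : (a, b) ≠ (i, j)) :
    Equiv.swap i j a < Equiv.swap i j b ∧ (Equiv.swap i j a, Equiv.swap i j b) ≠ (i, j) := by
  have h1 := h.iff a
  have h2 := h.iff b
  have h3 := h.lt
  simp only [ne_eq, Prod.mk.injEq, Equiv.swap_apply_def] at *
  grind

/-- The product of the two-particle factors, except that of the pair `(i, j)`, is compatible with
the transposition of two adjacent indices. -/
theorem Adjacent.prod_erase_comp_swap {i j : ι} (h : Adjacent i j) (g : ℂ → ℂ → ℂ) (S : Finset ι)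
    (ξ : ι → ℂ) :
    ∏ z ∈ (incPairs S).erase (i, j), g ((ξ ∘ Equiv.swap i j) z.1) ((ξ ∘ Equiv.swap i j) z.2) =
      ∏ z ∈ (incPairs (S.map (Equiv.swap i j).toEmbedding)).erase (i, j), g (ξ z.1) (ξ z.2) := by
  refine Finset.prod_equiv ((Equiv.swap i j).prodCongr (Equiv.swap i j)) ?_ fun _ _ => rfl
  rintro ⟨a, b⟩
  simp only [Finset.mem_erase, mem_incPairs, Equiv.prodCongr_apply, Prod.map_apply,
    Finset.mem_map_equiv, Equiv.symm_apply_apply]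
  constructor
  · rintro ⟨h1, h2, h3⟩
    obtain ⟨h4, h5⟩ := h.swap_lt h3 h1
    exact ⟨h5, h2, h4⟩
  · rintro ⟨h1, h2, h3⟩
    obtain ⟨h4, h5⟩ := h.swap_lt h3 h1
    rw [Equiv.swap_apply_self, Equiv.swap_apply_self] at h4 h5
    exact ⟨h5, h2, h4⟩

theorem wave_comp_swap {p q t : ℝ} {x : ℤ} {Y : ι → ℤ} {S : Finset ι} {i j : ι}
    (h : Adjacent i j) (hS : ¬ (i ∈ S ∧ j ∈ S)) (ξ : ι → ℂ) :
    wave p q t x Y S (ξ ∘ Equiv.swap i j) =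
      wave p q t x (Y ∘ Equiv.swap i j) (S.map (Equiv.swap i j).toEmbedding) ξ := by
  unfold wave
  congr 1
  · have := h.prod_erase_comp_swap (scatter p q) S ξ
    rwa [Finset.erase_eq_of_notMem (by simp; tauto),
      Finset.erase_eq_of_notMem (by simp; tauto)] at this
  · refine Finset.prod_equiv (Equiv.swap i j) (by simp) fun k _ => ?_
    simp

/-- If both of two adjacent particles belong to `S`, the boundary term is antisymmetric. -/
theorem wave_boundary_antisymm {p q R t : ℝ} (hR : IsLarge p q R) {x : ℤ} {Y : ι → ℤ}
    {S : Finset ι} {i j : ι} (h : Adjacent i j) (hi : i ∈ S) (hj : j ∈ S) (hY : Y j = Y i + 1)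
    {ξ : ι → ℂ} (hξ : ∀ i, R ≤ ‖ξ i‖) :
    let B := fun ξ => p * wave p q t x (Function.update Y i (Y i + 1)) S ξ +
      q * wave p q t x (Function.update Y j (Y j + -1)) S ξ - wave p q t x Y S ξ
    B (ξ ∘ Equiv.swap i j) = - B ξ := by
  intro B
  have hne : i ≠ j := h.lt.ne
  have hB : ∀ ξ : ι → ℂ, (∀ i, R ≤ ‖ξ i‖) → B ξ =
      (∏ z ∈ (incPairs S).erase (i, j), scatter p q (ξ z.1) (ξ z.2)) *
      (∏ k ∈ (S.erase i).erase j, single p q t (x - Y k) (ξ k)) *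
      ((ξ j - ξ i) * (single p q t (x - Y i) (ξ i) * single p q t (x - Y i) (ξ j)) *
        (ξ i)⁻¹ * (ξ j)⁻¹) := by
    intro ξ hξ
    have h0 := hR.ne_zero (hξ i)
    have h1 := hR.ne_zero (hξ j)
    have hd := hR.den_ne_zero (hξ i) (hξ j)
    simp only [B]
    rw [wave_update hi h0, wave_update hj h1]
    unfold wave
    rw [← Finset.mul_prod_erase (incPairs S) _ (show (i, j) ∈ incPairs S by simp [hi, hj, h.lt]),
      ← Finset.mul_prod_erase S _ hi,
      ← Finset.mul_prod_erase (S.erase i) _ (Finset.mem_erase.2 ⟨hne.symm, hj⟩)]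
    have hs : single p q t (x - Y j) (ξ j) = (ξ j)⁻¹ * single p q t (x - Y i) (ξ j) := by
      unfold single
      rw [hY, show x - (Y i + 1) = -1 + (x - Y i) by ring, zpow_add₀ h1, zpow_neg_one]
      ring
    rw [hs]
    simp only [zpow_neg, zpow_one, neg_neg]
    generalize ∏ z ∈ (incPairs S).erase (i, j), scatter p q (ξ z.1) (ξ z.2) = A
    have hsc : ((p : ℂ) + q * ξ i * ξ j - ξ i) * scatter p q (ξ i) (ξ j) = ξ j - ξ i :=
      mul_div_cancel₀ _ hd
    generalize ∏ k ∈ (S.erase i).erase j, single p q t (x - Y k) (ξ k) = P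
    linear_combination (A * P * single p q t (x - Y i) (ξ i) * single p q t (x - Y i) (ξ j) *
      (ξ i)⁻¹ * (ξ j)⁻¹) * hsc - ((q * ξ j - 1) * A * P * single p q t (x - Y i) (ξ i) *
      single p q t (x - Y i) (ξ j) * (ξ j)⁻¹ * scatter p q (ξ i) (ξ j)) * mul_inv_cancel₀ h0
  have hsw : ∀ k, R ≤ ‖(ξ ∘ Equiv.swap i j) k‖ := fun k => hξ _
  rw [hB _ hξ, hB _ hsw, h.prod_erase_comp_swap]
  have hS : S.map (Equiv.swap i j).toEmbedding = S := by
    ext k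
    simp only [Finset.mem_map_equiv, Equiv.symm_swap, Equiv.swap_apply_def]
    grind
  have hp : ∏ k ∈ (S.erase i).erase j, single p q t (x - Y k) ((ξ ∘ Equiv.swap i j) k) =
      ∏ k ∈ (S.erase i).erase j, single p q t (x - Y k) (ξ k) := by
    refine Finset.prod_congr rfl fun k hk => ?_
    simp only [Finset.mem_erase] at hk
    rw [Function.comp, Equiv.swap_apply_of_ne_of_ne hk.2.1 hk.1]
  have h0 := hR.ne_zero (hξ i)
  have h1 := hR.ne_zero (hξ j)
  rw [hS, hp]
  simp only [Function.comp, Equiv.swap_apply_left, Equiv.swap_apply_right]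
  field_simp
  ring

section

variable [Fintype ι]

theorem IsLarge.holOutside_wave {p q R : ℝ} (hR : IsLarge p q R) (t : ℝ) (x : ℤ) (Y : ι → ℤ)
    (S : Finset ι) : HolOutside R (wave p q t x Y S) :=
  (HolOutside.prod fun z _ => hR.holOutside_scatter z.1 z.2).mul
    (HolOutside.prod fun i _ => hR.holOutside_single t _ i)

theorem IsLarge.continuousOn_wave {p q R : ℝ} (hR : IsLarge p q R) (t : ℝ) (x : ℤ) (Y : ι → ℤ)
    (S : Finset ι) : ContinuousOn (wave p q t x Y S) (torus fun _ => R) :=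
  (hR.holOutside_wave t x Y S).continuousOn fun _ => le_rfl

theorem IsLarge.integrable_wave {p q R : ℝ} (hR : IsLarge p q R) (t : ℝ) (x : ℤ) (Y : ι → ℤ)
    (S : Finset ι) : Integrable (wave p q t x Y S) (torusMeasure fun _ => R) :=
  integrable_torusMeasure (fun _ => hR.pos.le) (hR.continuousOn_wave t x Y S)

/-- The contribution of `S` to the formula for `P(x₁(t) ≥ x)`, without its coefficient. -/
def waveIntegral (p q t : ℝ) (x : ℤ) (R : ℝ) (Y : ι → ℤ) (S : Finset ι) : ℂ :=
  ∫ ξ, wave p q t x Y S ξ ∂torusMeasure fun _ => R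

theorem waveIntegral_congr {p q t R : ℝ} {x : ℤ} {Y Y' : ι → ℤ} {S : Finset ι}
    (h : ∀ i ∈ S, Y i = Y' i) : waveIntegral p q t x R Y S = waveIntegral p q t x R Y' S := by
  unfold waveIntegral
  congr 1
  ext ξ
  exact wave_congr h ξ

theorem IsLarge.waveIntegral_swap {p q R : ℝ} (hR : IsLarge p q R) {t : ℝ} {x : ℤ} {Y : ι → ℤ}
    {S : Finset ι} {i j : ι} (h : Adjacent i j) (hS : ¬ (i ∈ S ∧ j ∈ S)) :
    waveIntegral p q t x R (Y ∘ Equiv.swap i j) (S.map (Equiv.swap i j).toEmbedding) =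
      waveIntegral p q t x R Y S := by
  unfold waveIntegral
  rw [← integral_torusMeasure_comp hR.pos.le (Equiv.swap i j).injective
    (hR.continuousOn_wave t x Y S)]
  congr 1
  ext ξ
  exact (wave_comp_swap h hS ξ).symm

/-- The free evolution equation. -/
theorem IsLarge.hasDerivAt_waveIntegral {p q R : ℝ} (hR : IsLarge p q R) (t : ℝ) (x : ℤ)
    (Y : ι → ℤ) (S : Finset ι) :
    HasDerivAt (fun t => waveIntegral p q t x R Y S)
      (∑ i, (p * waveIntegral p q t x R (Function.update Y i (Y i + 1)) S +
        q * waveIntegral p q t x R (Function.update Y i (Y i + -1)) S -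
          waveIntegral p q t x R Y S)) t := by
  have hE : ContinuousOn (fun ξ : ι → ℂ => ∑ i ∈ S, eps p q (ξ i)) (torus fun _ => R) := by
    refine continuousOn_finsetSum _ fun i _ ξ hξ => ?_
    have h0 := hR.ne_zero (hξ i).ge
    exact (ContinuousAt.comp (f := fun ξ : ι → ℂ => ξ i) (differentiableAt_eps h0).continuousAt
      (continuousAt_apply i ξ)).continuousWithinAt
  have h := hasDerivAt_integral_mul_exp (fun _ => hR.pos.le) (hR.continuousOn_wave 0 x Y S) hE t
  simp only [← wave_eq_mul_exp] at h
  refine h.congr_deriv ?_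
  unfold waveIntegral
  have hint := fun Y => hR.integrable_wave t x Y S
  simp only [← integral_const_mul]
  have hterm : ∀ i : ι, Integrable (fun ξ => p * wave p q t x (Function.update Y i (Y i + 1)) S ξ +
      q * wave p q t x (Function.update Y i (Y i + -1)) S ξ - wave p q t x Y S ξ)
      (torusMeasure fun _ => R) := fun i =>
    (((hint _).const_mul _).add ((hint _).const_mul _)).sub (hint _)
  have hsum : ∀ i : ι, (∫ ξ, p * wave p q t x (Function.update Y i (Y i + 1)) S ξ
        ∂torusMeasure fun _ => R) +
      (∫ ξ, q * wave p q t x (Function.update Y i (Y i + -1)) S ξ ∂torusMeasure fun _ => R) -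
      (∫ ξ, wave p q t x Y S ξ ∂torusMeasure fun _ => R) =
      ∫ ξ, p * wave p q t x (Function.update Y i (Y i + 1)) S ξ +
        q * wave p q t x (Function.update Y i (Y i + -1)) S ξ - wave p q t x Y S ξ
        ∂torusMeasure fun _ => R := fun i => by
    rw [← integral_add ((hint _).const_mul _) ((hint _).const_mul _),
      ← integral_sub (by exact ((hint _).const_mul _).add ((hint _).const_mul _)) (hint _)]
  rw [Finset.sum_congr rfl fun i _ => hsum i, ← integral_finsetSum _ fun i _ => hterm i]
  refine integral_congr_ae ?_
  filter_upwards [ae_torusMeasure fun _ => hR.pos.le] with ξ hξ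
  rw [Finset.sum_mul, ← Finset.sum_subset (Finset.subset_univ S)]
  · refine Finset.sum_congr rfl fun i hi => ?_
    have h0 := hR.ne_zero (hξ i).ge
    rw [wave_update hi h0, wave_update hi h0, eps]
    simp only [zpow_neg, zpow_one, inv_inv]
    ring
  · intro i _ hi
    rw [wave_update_of_notMem hi, wave_update_of_notMem hi, ← add_mul, ← Complex.ofReal_add,
      hR.add_eq]
    simp

end

end

section

theorem map_swap_eq_self {ι : Type*} [DecidableEq ι] {S : Finset ι} {i j : ι}
    (h : i ∈ S ↔ j ∈ S) : S.map (Equiv.swap i j).toEmbedding = S := by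
  ext k
  simp only [Finset.mem_map_equiv, Equiv.symm_swap, Equiv.swap_apply_def]
  grind

section

variable {ι : Type*} [LinearOrder ι] [Fintype ι] {p q t R : ℝ} {x : ℤ} {Y : ι → ℤ}
  {S : Finset ι} {i j : ι}

theorem waveIntegral_update_of_notMem (hi : i ∉ S) (d : ℤ) :
    waveIntegral p q t x R (Function.update Y i d) S = waveIntegral p q t x R Y S :=
  waveIntegral_congr fun j hj => by rw [Function.update_of_ne (by rintro rfl; exact hi hj)]

/-- The boundary term vanishes if both particles belong to `S`. -/
theorem IsLarge.boundary_of_mem (hR : IsLarge p q R) (h : Adjacent i j) (hi : i ∈ S) (hj : j ∈ S)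
    (hY : Y j = Y i + 1) :
    p * waveIntegral p q t x R (Function.update Y i (Y i + 1)) S +
      q * waveIntegral p q t x R (Function.update Y j (Y j + -1)) S -
      waveIntegral p q t x R Y S = 0 := by
  have hint := fun Y => hR.integrable_wave t x Y S
  unfold waveIntegral
  simp only [← integral_const_mul]
  rw [← integral_add ((hint _).const_mul _) ((hint _).const_mul _),
    ← integral_sub (by exact ((hint _).const_mul _).add ((hint _).const_mul _)) (hint _)]
  set B : (ι → ℂ) → ℂ := fun ξ => p * wave p q t x (Function.update Y i (Y i + 1)) S ξ +
    q * wave p q t x (Function.update Y j (Y j + -1)) S ξ - wave p q t x Y S ξ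
  have hc := fun Y => hR.continuousOn_wave t x Y S
  have h1 : ∫ ξ, B (ξ ∘ Equiv.swap i j) ∂torusMeasure (fun _ : ι => R) =
      ∫ ξ, B ξ ∂torusMeasure (fun _ : ι => R) :=
    integral_torusMeasure_comp hR.pos.le (Equiv.swap i j).injective
      (((continuousOn_const.mul (hc _)).add (continuousOn_const.mul (hc _))).sub (hc Y))
  have h2 : ∫ ξ, B (ξ ∘ Equiv.swap i j) ∂torusMeasure (fun _ : ι => R) =
      ∫ ξ, -B ξ ∂torusMeasure (fun _ : ι => R) :=
    integral_congr_ae <| (ae_torusMeasure fun _ => hR.pos.le).mono fun ξ hξ =>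
      wave_boundary_antisymm hR h hi hj hY fun i => (hξ i).ge
  rw [integral_neg] at h2
  exact self_eq_neg.1 (h1.symm.trans h2)

/-- The two boundary terms of the index sets containing exactly one of the two particles. -/
theorem IsLarge.boundary_of_notMem (hR : IsLarge p q R) (h : Adjacent i j) (hi : i ∈ S)
    (hj : j ∉ S) (hY : Y j = Y i + 1) {c c' : ℂ} (hc : c' * q = p * c) :
    c * (p * waveIntegral p q t x R (Function.update Y i (Y i + 1)) S +
      q * waveIntegral p q t x R (Function.update Y j (Y j + -1)) S -
      waveIntegral p q t x R Y S) +
    c' * (p * waveIntegral p q t x R (Function.update Y i (Y i + 1))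
        (S.map (Equiv.swap i j).toEmbedding) +
      q * waveIntegral p q t x R (Function.update Y j (Y j + -1))
        (S.map (Equiv.swap i j).toEmbedding) -
      waveIntegral p q t x R Y (S.map (Equiv.swap i j).toEmbedding)) = 0 := by
  have hS : ¬ (i ∈ S ∧ j ∈ S) := fun h => hj h.2
  have hcomp : ∀ Y : ι → ℤ, (Y ∘ Equiv.swap i j) ∘ Equiv.swap i j = Y := fun Y => by
    ext k; simp
  have hsw : ∀ Y : ι → ℤ, waveIntegral p q t x R Y (S.map (Equiv.swap i j).toEmbedding) =
      waveIntegral p q t x R (Y ∘ Equiv.swap i j) S := fun Y => by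
    rw [← hR.waveIntegral_swap h hS, hcomp]
  have hiS : i ∉ S.map (Equiv.swap i j).toEmbedding := by simpa [Finset.mem_map_equiv] using hj
  have e1 : waveIntegral p q t x R Y (S.map (Equiv.swap i j).toEmbedding) =
      waveIntegral p q t x R (Function.update Y i (Y i + 1)) S := by
    rw [hsw]
    refine waveIntegral_congr fun k hk => ?_
    by_cases hki : k = i
    · subst hki; simp [hY]
    · have : k ≠ j := by rintro rfl; exact hj hk
      simp [Function.update_of_ne hki, Equiv.swap_apply_of_ne_of_ne hki this]
  have e2 : waveIntegral p q t x R (Function.update Y j (Y j + -1))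
      (S.map (Equiv.swap i j).toEmbedding) = waveIntegral p q t x R Y S := by
    rw [hsw]
    refine waveIntegral_congr fun k hk => ?_
    by_cases hki : k = i
    · subst hki; simp [hY]
    · have : k ≠ j := by rintro rfl; exact hj hk
      simp [Function.update_of_ne this, Equiv.swap_apply_of_ne_of_ne hki this]
  rw [e2, waveIntegral_update_of_notMem hiS, waveIntegral_update_of_notMem hj, e1]
  have hpq : (p : ℂ) + q = 1 := by rw [← Complex.ofReal_add, hR.add_eq, Complex.ofReal_one]
  generalize waveIntegral p q t x R (Function.update Y i (Y i + 1)) S = a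
  generalize waveIntegral p q t x R Y S = b
  linear_combination (b - a) * hc + (c * b + c' * a) * hpq

end

variable {N : ℕ}

/-- The coefficient of the index set `S` (with indices counted from `0`). -/
def weight (p q : ℝ) (S : Finset (Fin N)) : ℝ :=
  (∏ i ∈ S, p ^ (i : ℕ) * q⁻¹ ^ ((i : ℕ) + 1)) * q ^ (S.card + 1).choose 2

theorem Adjacent.val_eq {i j : Fin N} (h : Adjacent i j) : (j : ℕ) = i + 1 := by
  have h1 : (i : ℕ) < j := h.lt
  by_contra hne
  have h2 := h.iff ⟨i + 1, by omega⟩ (by simp [Fin.ext_iff]) (by simp [Fin.ext_iff]; omega)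
  simp only [Fin.lt_def] at h2
  omega

theorem weight_swap {p q : ℝ} (hq : q ≠ 0) {i j : Fin N} (h : Adjacent i j) {S : Finset (Fin N)}
    (hi : i ∈ S) (hj : j ∉ S) :
    weight p q (S.map (Equiv.swap i j).toEmbedding) * q = p * weight p q S := by
  have hS : S.map (Equiv.swap i j).toEmbedding = insert j (S.erase i) := by
    ext k
    simp only [Finset.mem_map_equiv, Equiv.symm_swap, Equiv.swap_apply_def, Finset.mem_insert,
      Finset.mem_erase]
    grind
  unfold weight
  rw [Finset.card_map, hS, Finset.prod_insert (by simp [hj]), ← Finset.mul_prod_erase S _ hi,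
    h.val_eq]
  have : q⁻¹ * q = 1 := inv_mul_cancel₀ hq
  linear_combination (p * p ^ (i : ℕ) * q⁻¹ ^ ((i : ℕ) + 1) *
    (∏ i ∈ S.erase i, p ^ (i : ℕ) * q⁻¹ ^ ((i : ℕ) + 1)) * q ^ (S.card + 1).choose 2) * this

/-- The formula for `P(x₁(t) ≥ x)`. -/
def tailFormula (p q t : ℝ) (x : ℤ) (R : ℝ) (Y : Fin N → ℤ) : ℂ :=
  ∑ S : Finset (Fin N), (weight p q S : ℂ) * waveIntegral p q t x R Y S

theorem IsLarge.hasDerivAt_tailFormula {p q R : ℝ} (hR : IsLarge p q R) (t : ℝ) (x : ℤ)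
    (Y : Fin N → ℤ) :
    HasDerivAt (fun t => tailFormula p q t x R Y)
      (∑ i, (p * tailFormula p q t x R (Function.update Y i (Y i + 1)) +
        q * tailFormula p q t x R (Function.update Y i (Y i + -1)) -
          tailFormula p q t x R Y)) t := by
  unfold tailFormula
  refine (HasDerivAt.fun_sum fun S _ =>
    (hR.hasDerivAt_waveIntegral t x Y S).const_mul (weight p q S : ℂ)).congr_deriv ?_
  simp only [Finset.mul_sum]
  rw [Finset.sum_comm]
  refine Finset.sum_congr rfl fun i _ => ?_
  rw [← Finset.sum_add_distrib, ← Finset.sum_sub_distrib]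
  exact Finset.sum_congr rfl fun S _ => by ring

theorem IsLarge.tailFormula_boundary {p q R : ℝ} (hR : IsLarge p q R) (t : ℝ) (x : ℤ)
    {Y : Fin N → ℤ} {i j : Fin N} (h : Adjacent i j) (hY : Y j = Y i + 1) :
    p * tailFormula p q t x R (Function.update Y i (Y i + 1)) +
      q * tailFormula p q t x R (Function.update Y j (Y j + -1)) = tailFormula p q t x R Y := by
  have key : ∑ S : Finset (Fin N), (weight p q S : ℂ) *
      (p * waveIntegral p q t x R (Function.update Y i (Y i + 1)) S +
      q * waveIntegral p q t x R (Function.update Y j (Y j + -1)) S -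
      waveIntegral p q t x R Y S) = 0 := by
    have hinv : ∀ S : Finset (Fin N), (S.map (Equiv.swap i j).toEmbedding).map
        (Equiv.swap i j).toEmbedding = S := fun S => by
      ext k; simp [Finset.mem_map_equiv]
    have hone : ∀ S : Finset (Fin N), i ∈ S → j ∉ S →
        (weight p q S : ℂ) * (p * waveIntegral p q t x R (Function.update Y i (Y i + 1)) S +
          q * waveIntegral p q t x R (Function.update Y j (Y j + -1)) S -
          waveIntegral p q t x R Y S) +
        (weight p q (S.map (Equiv.swap i j).toEmbedding) : ℂ) *
          (p * waveIntegral p q t x R (Function.update Y i (Y i + 1))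
            (S.map (Equiv.swap i j).toEmbedding) +
          q * waveIntegral p q t x R (Function.update Y j (Y j + -1))
            (S.map (Equiv.swap i j).toEmbedding) -
          waveIntegral p q t x R Y (S.map (Equiv.swap i j).toEmbedding)) = 0 :=
      fun S hi hj => hR.boundary_of_notMem h hi hj hY
        (by exact_mod_cast weight_swap hR.q_pos.ne' h hi hj)
    have hzero : ∀ S : Finset (Fin N), (i ∈ S ↔ j ∈ S) →
        p * waveIntegral p q t x R (Function.update Y i (Y i + 1)) S +
          q * waveIntegral p q t x R (Function.update Y j (Y j + -1)) S -
          waveIntegral p q t x R Y S = 0 := by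
      intro S hij
      by_cases hi : i ∈ S
      · exact hR.boundary_of_mem h hi (hij.1 hi) hY
      · rw [waveIntegral_update_of_notMem hi, waveIntegral_update_of_notMem (fun h => hi (hij.2 h)),
          ← add_mul, ← Complex.ofReal_add, hR.add_eq]
        simp
    refine Finset.sum_involution (fun S _ => S.map (Equiv.swap i j).toEmbedding) ?_ ?_
      (fun _ _ => Finset.mem_univ _) fun S _ => hinv S
    · intro S _
      by_cases hij : i ∈ S ↔ j ∈ S
      · rw [map_swap_eq_self hij, hzero S hij]; simp
      · by_cases hi : i ∈ S
        · exact hone S hi (by tauto)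
        · have := hone (S.map (Equiv.swap i j).toEmbedding)
            (by simp [Finset.mem_map_equiv]; tauto) (by simpa [Finset.mem_map_equiv] using hi)
          rw [hinv, add_comm] at this
          exact this
    · intro S _ hS heq
      refine hS ?_
      rw [hzero S, mul_zero]
      have : i ∈ S.map (Equiv.swap i j).toEmbedding ↔ i ∈ S := by rw [heq]
      simp only [Finset.mem_map_equiv, Equiv.symm_swap, Equiv.swap_apply_left] at this
      exact this.symm
  unfold tailFormula
  rw [Finset.mul_sum, Finset.mul_sum, ← Finset.sum_add_distrib, ← sub_eq_zero,
    ← Finset.sum_sub_distrib, ← key]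
  exact Finset.sum_congr rfl fun S _ => by ring

theorem Config.adjacent {η : Config N} {i j : Fin N} (h : η.1 j = η.1 i + 1) : Adjacent i j := by
  refine ⟨η.2.lt_iff_lt.1 (by omega), fun k hi hj => ?_⟩
  have h1 := η.2.injective.ne hi
  rw [← η.2.lt_iff_lt, ← η.2.lt_iff_lt]
  omega

/-- A function satisfying the boundary conditions is mapped by the generator of the exclusion
process to its image under the generator of independent particles. -/
theorem sum_generator_eq_sum_free {p q : ℝ} (hpq : p + q = 1) (u : (Fin N → ℤ) → ℂ) (η : Config N)
    (hu : ∀ i j, η.1 j = η.1 i + 1 → p * u (Function.update η.1 i (η.1 i + 1)) +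
      q * u (Function.update η.1 j (η.1 j + -1)) = u η.1) :
    ∑ i, (p * (u (jumpRight i η).1 - u η.1) + q * (u (jumpLeft i η).1 - u η.1)) =
      ∑ i, (p * u (Function.update η.1 i (η.1 i + 1)) +
        q * u (Function.update η.1 i (η.1 i + -1)) - u η.1) := by
  have hpq' : (p : ℂ) + q = 1 := by rw [← Complex.ofReal_add, hpq, Complex.ofReal_one]
  have hright : ∀ i, p * (u (jumpRight i η).1 - u η.1) =
      p * (u (Function.update η.1 i (η.1 i + 1)) - u η.1) - ∑ j, if η.1 j = η.1 i + 1 then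
        p * (u (Function.update η.1 i (η.1 i + 1)) - u η.1) else 0 := by
    intro i
    by_cases hv : ∀ j, η.1 j ≠ η.1 i + 1
    · rw [jumpRight, dif_pos hv, Finset.sum_eq_zero fun j _ => if_neg (hv j), sub_zero]
    · rw [jumpRight, dif_neg hv]
      push Not at hv
      obtain ⟨j, hj⟩ := hv
      rw [Finset.sum_eq_single j (fun k _ hk => if_neg fun hk' =>
        hk (η.2.injective (hk'.trans hj.symm))) (by simp), if_pos hj]
      simp
  have hleft : ∀ j, q * (u (jumpLeft j η).1 - u η.1) =
      q * (u (Function.update η.1 j (η.1 j + -1)) - u η.1) - ∑ i, if η.1 j = η.1 i + 1 then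
        q * (u (Function.update η.1 j (η.1 j + -1)) - u η.1) else 0 := by
    intro j
    by_cases hv : ∀ i, η.1 i ≠ η.1 j + -1
    · rw [jumpLeft, dif_pos hv, Finset.sum_eq_zero fun i _ => if_neg fun h => hv i (by omega),
        sub_zero]
    · rw [jumpLeft, dif_neg hv]
      push Not at hv
      obtain ⟨i, hi⟩ := hv
      rw [Finset.sum_eq_single i (fun k _ hk => if_neg fun hk' =>
        hk (η.2.injective (by omega))) (by simp), if_pos (by omega)]
      simp
  have hz : (∑ i, ∑ j, if η.1 j = η.1 i + 1 then
        p * (u (Function.update η.1 i (η.1 i + 1)) - u η.1) else 0) +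
      (∑ j, ∑ i, if η.1 j = η.1 i + 1 then
        q * (u (Function.update η.1 j (η.1 j + -1)) - u η.1) else 0) = 0 := by
    rw [Finset.sum_comm (f := fun j i => if η.1 j = η.1 i + 1 then
        q * (u (Function.update η.1 j (η.1 j + -1)) - u η.1) else 0), ← Finset.sum_add_distrib]
    refine Finset.sum_eq_zero fun i _ => ?_
    rw [← Finset.sum_add_distrib]
    refine Finset.sum_eq_zero fun j _ => ?_
    split_ifs with h
    · linear_combination hu i j h - u η.1 * hpq'
    · simp
  rw [Finset.sum_add_distrib, Finset.sum_congr rfl fun i _ => hright i,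
    Finset.sum_congr rfl fun j _ => hleft j, Finset.sum_sub_distrib, Finset.sum_sub_distrib]
  have hfree : ∑ i, (p * u (Function.update η.1 i (η.1 i + 1)) +
        q * u (Function.update η.1 i (η.1 i + -1)) - u η.1) =
      ∑ i, p * (u (Function.update η.1 i (η.1 i + 1)) - u η.1) +
        ∑ i, q * (u (Function.update η.1 i (η.1 i + -1)) - u η.1) := by
    rw [← Finset.sum_add_distrib]
    exact Finset.sum_congr rfl fun i _ => by linear_combination u η.1 * hpq'
  rw [hfree]
  linear_combination -hz

/-- The formula solves the backward equation of the exclusion process. -/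
theorem IsLarge.hasDerivAt_tailFormula_config {p q R : ℝ} (hR : IsLarge p q R) (t : ℝ) (x : ℤ)
    (η : Config N) :
    HasDerivAt (fun t => tailFormula p q t x R η.1)
      (∑ i, (p * (tailFormula p q t x R (jumpRight i η).1 - tailFormula p q t x R η.1) +
        q * (tailFormula p q t x R (jumpLeft i η).1 - tailFormula p q t x R η.1))) t := by
  rw [sum_generator_eq_sum_free hR.add_eq (tailFormula p q t x R) η fun i j h =>
    hR.tailFormula_boundary t x (Config.adjacent h) h]
  exact hR.hasDerivAt_tailFormula t x η.1

end

section

/-- The residue theorem for finitely many simple poles. -/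
theorem circleAverage_div_prod {ι : Type*} [DecidableEq ι] {s : Finset ι} (hs : s.Nonempty)
    {a : ι → ℂ} (ha : InjOn a s) {ρ : ℝ} (hρ : ∀ i ∈ s, ‖a i‖ < ρ) {h : ℂ → ℂ}
    (hh : Differentiable ℂ h) :
    Real.circleAverage (fun z => z * h z / ∏ i ∈ s, (z - a i)) 0 ρ =
      ∑ i ∈ s, Lagrange.nodalWeight s a i * h (a i) := by
  have hρ0 : 0 < ρ := by
    obtain ⟨i, hi⟩ := hs
    exact (norm_nonneg _).trans_lt (hρ i hi)
  have hne : ∀ z ∈ Metric.sphere (0 : ℂ) |ρ|, ∀ i ∈ s, z ≠ a i := by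
    rintro z hz i hi rfl
    rw [mem_sphere_zero_iff_norm, abs_of_pos hρ0] at hz
    exact (hρ i hi).ne hz
  have h1 : EqOn (fun z => z * h z / ∏ i ∈ s, (z - a i))
      (fun z => ∑ i ∈ s, Lagrange.nodalWeight s a i • ((z - 0) / (z - a i)) • h z)
      (Metric.sphere 0 |ρ|) := by
    intro z hz
    have h2 := Lagrange.eval_interpolate_not_at_node (s := s) (v := a) 1 (hne z hz)
    rw [Lagrange.interpolate_one ha hs, Polynomial.eval_one, Lagrange.eval_nodal] at h2
    have h3 : ∏ i ∈ s, (z - a i) ≠ 0 :=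
      Finset.prod_ne_zero_iff.2 fun i hi => sub_ne_zero.2 (hne z hz i hi)
    simp only [smul_eq_mul, sub_zero]
    rw [div_eq_iff h3]
    calc z * h z = z * h z * 1 := by ring
      _ = _ := by
        rw [h2, Finset.mul_sum, Finset.mul_sum, Finset.sum_mul]
        refine Finset.sum_congr rfl fun i _ => ?_
        simp only [Pi.one_apply]
        ring
  rw [Real.circleAverage_congr_sphere h1, Real.circleAverage_fun_sum]
  · refine Finset.sum_congr rfl fun i hi => ?_
    rw [Real.circleAverage_fun_smul, DiffContOnCl.circleAverage_smul_div hh.diffContOnCl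
      (by simpa [abs_of_pos hρ0] using hρ i hi), smul_eq_mul]
  · intro i hi
    refine ContinuousOn.circleIntegrable' fun z hz => ?_
    have h4 : z - a i ≠ 0 := sub_ne_zero.2 (hne z hz i hi)
    have h5 := hh.continuous
    exact ContinuousAt.continuousWithinAt (by fun_prop (disch := assumption))

/-- The zero `p / (1 - q w)` of `z ↦ p + q z w - z`. -/
def pole (p q : ℝ) (w : ℂ) : ℂ := p / (1 - q * w)

namespace IsLarge

variable {p q R : ℝ}

theorem le_norm_q_mul_sub_one (hR : IsLarge p q R) {w : ℂ} (hw : R ≤ ‖w‖) :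
    3 ≤ ‖(q : ℂ) * w - 1‖ ∧ q / 2 * ‖w‖ ≤ ‖(q : ℂ) * w - 1‖ := by
  have h1 := norm_sub_norm_le ((q : ℂ) * w) 1
  rw [norm_mul, Complex.norm_real, Real.norm_of_nonneg hR.q_pos.le, norm_one] at h1
  have h2 : 4 ≤ q * ‖w‖ := hR.large.trans (mul_le_mul_of_nonneg_left hw hR.q_pos.le)
  constructor <;> linarith

theorem q_mul_sub_one_ne_zero (hR : IsLarge p q R) {w : ℂ} (hw : R ≤ ‖w‖) :
    (q : ℂ) * w - 1 ≠ 0 := by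
  have := (hR.le_norm_q_mul_sub_one hw).1
  exact norm_pos_iff.1 (by linarith)

theorem one_sub_q_mul_ne_zero (hR : IsLarge p q R) {w : ℂ} (hw : R ≤ ‖w‖) :
    1 - (q : ℂ) * w ≠ 0 := by
  rw [← neg_sub]
  exact neg_ne_zero.2 (hR.q_mul_sub_one_ne_zero hw)

theorem norm_pole_le (hR : IsLarge p q R) {w : ℂ} (hw : R ≤ ‖w‖) :
    ‖pole p q w‖ ≤ 1 ∧ ‖pole p q w‖ ≤ 2 / q / ‖w‖ := by
  obtain ⟨h1, h2⟩ := hR.le_norm_q_mul_sub_one hw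
  have hp : p ≤ 1 := by linarith [hR.q_pos, hR.add_eq]
  have hw0 : 0 < ‖w‖ := hR.pos.trans_le hw
  have hq := hR.q_pos
  have hn : ‖pole p q w‖ = p / ‖(q : ℂ) * w - 1‖ := by
    rw [pole, norm_div, Complex.norm_real, Real.norm_of_nonneg hR.p_nonneg, norm_sub_rev]
  rw [hn]
  constructor
  · exact div_le_one_of_le₀ (by linarith) (norm_nonneg _)
  · rw [div_div, div_le_div_iff₀ (by linarith) (by positivity)]
    exact (mul_le_of_le_one_left (by positivity) hp).trans (by linarith)

theorem p_add_eq (hR : IsLarge p q R) : (p : ℂ) = 1 - q := by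
  rw [← Complex.ofReal_one, ← hR.add_eq]; push_cast; ring

theorem pole_sub_one (hR : IsLarge p q R) {w : ℂ} (hw : R ≤ ‖w‖) :
    pole p q w - 1 = - (q * (1 - w) / (1 - q * w)) := by
  have := hR.one_sub_q_mul_ne_zero hw
  rw [pole, hR.p_add_eq]
  field_simp
  ring

theorem pole_ne_one (hR : IsLarge p q R) {w : ℂ} (hw : R ≤ ‖w‖) : pole p q w ≠ 1 := by
  rw [← sub_ne_zero, hR.pole_sub_one hw]
  have h1 := hR.one_sub_q_mul_ne_zero hw
  have h2 := hR.one_sub_ne_zero hw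
  have h3 : (q : ℂ) ≠ 0 := by exact_mod_cast hR.q_pos.ne'
  exact neg_ne_zero.2 (div_ne_zero (mul_ne_zero h3 h2) h1)

theorem pole_injOn (hR : IsLarge p q R) (hp : p ≠ 0) : InjOn (pole p q) {w | R ≤ ‖w‖} := by
  intro w hw w' hw' h
  have h1 := hR.one_sub_q_mul_ne_zero hw
  have h2 := hR.one_sub_q_mul_ne_zero hw'
  have h3 : (q : ℂ) ≠ 0 := by exact_mod_cast hR.q_pos.ne'
  have h4 : (p : ℂ) ≠ 0 := by exact_mod_cast hp
  rw [pole, pole, div_eq_div_iff h1 h2] at h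
  have h5 := mul_left_cancel₀ h4 h
  exact mul_left_cancel₀ h3 (by linear_combination h5)

theorem scatter_eq (hR : IsLarge p q R) {w : ℂ} (hw : R ≤ ‖w‖) (z : ℂ) :
    scatter p q z w = (w - z) / (q * w - 1) * (z - pole p q w)⁻¹ := by
  have h1 := hR.q_mul_sub_one_ne_zero hw
  have h2 := hR.one_sub_q_mul_ne_zero hw
  have : (p : ℂ) + q * z * w - z = (q * w - 1) * (z - pole p q w) := by
    rw [pole]; field_simp; ring
  rw [scatter, this, div_eq_mul_inv, mul_inv]
  ring

end IsLarge

/-- The residue of the integrand in the first variable at the pole produced by `w k`. -/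
def poleResidue {ι : Type*} [DecidableEq ι] (p q : ℝ) (m : ℕ) (S : Finset ι) (w : ι → ℂ) (k : ι) :
    ℂ :=
  -(pole p q (w k) ^ m) / (pole p q (w k) - 1) * ((w k - pole p q (w k)) / (q * w k - 1)) *
    ∏ j ∈ S.erase k, scatter p q (pole p q (w k)) (w j)

theorem IsLarge.circleAverage_prod_scatter {p q R : ℝ} (hR : IsLarge p q R) {ι : Type*}
    [DecidableEq ι] {S : Finset ι} (hp : ∀ k ∈ S, p ≠ 0) {w : ι → ℂ} (hw : ∀ k ∈ S, R ≤ ‖w k‖)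
    (hinj : InjOn w S) {ρ : ℝ} (hρ : R ≤ ρ) (m : ℕ) {i : ι} (hi : i ∉ S) :
    Real.circleAverage (fun z => z ^ (m + 1) / (1 - z) * ∏ k ∈ S, scatter p q z (w k)) 0 ρ =
      -(q⁻¹ : ℂ) ^ S.card + ∑ k ∈ S, poleResidue p q m S w k := by
  set a : ι → ℂ := Function.update (fun k => pole p q (w k)) i 1 with ha
  have hai : a i = 1 := by simp [ha]
  have hak : ∀ k ∈ S, a k = pole p q (w k) := fun k hk => by
    rw [ha, Function.update_of_ne (by rintro rfl; exact hi hk)]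
  have hainj : InjOn a (insert i S : Finset ι) := by
    intro k hk l hl hkl
    simp only [Finset.coe_insert, mem_insert_iff, Finset.mem_coe] at hk hl
    rcases hk with rfl | hk <;> rcases hl with rfl | hl
    · rfl
    · rw [hai, hak l hl] at hkl
      exact absurd hkl.symm (hR.pole_ne_one (hw l hl))
    · rw [hai, hak k hk] at hkl
      exact absurd hkl (hR.pole_ne_one (hw k hk))
    · rw [hak k hk, hak l hl] at hkl
      exact hinj hk hl (hR.pole_injOn (hp k hk) (hw k hk) (hw l hl) hkl)
  have harho : ∀ k ∈ insert i S, ‖a k‖ < ρ := by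
    intro k hk
    have := hR.four_le
    rcases Finset.mem_insert.1 hk with rfl | hk
    · rw [hai, norm_one]; linarith
    · rw [hak k hk]; linarith [(hR.norm_pole_le (hw k hk)).1]
  set h : ℂ → ℂ := fun z => -(z ^ m * ∏ k ∈ S, (w k - z) / (q * w k - 1)) with hh
  have hhd : Differentiable ℂ h := by
    have : ∀ T : Finset ι, Differentiable ℂ fun z => ∏ k ∈ T, (w k - z) / (q * w k - 1) := by
      intro T
      induction T using Finset.induction_on with
      | empty => simp
      | insert k T hk ih =>
        simp only [Finset.prod_insert hk]
        fun_prop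
    have := this S
    fun_prop
  have hf : (fun z => z ^ (m + 1) / (1 - z) * ∏ k ∈ S, scatter p q z (w k)) =
      fun z => z * h z / ∏ k ∈ insert i S, (z - a k) := by
    ext z
    have h1 : ∏ k ∈ S, scatter p q z (w k) =
        (∏ k ∈ S, (w k - z) / (q * w k - 1)) * (∏ k ∈ S, (z - a k))⁻¹ := by
      rw [← Finset.prod_inv_distrib, ← Finset.prod_mul_distrib]
      exact Finset.prod_congr rfl fun k hk => by rw [hR.scatter_eq (hw k hk), hak k hk]
    rw [h1, Finset.prod_insert hi, hai, hh, ← neg_sub z 1, div_eq_mul_inv, div_eq_mul_inv, mul_inv,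
      inv_neg]
    ring
  rw [hf, circleAverage_div_prod (Finset.insert_nonempty _ _) hainj harho hhd,
    Finset.sum_insert hi]
  congr 1
  · rw [Lagrange.nodalWeight, Finset.erase_insert hi, hai, hh]
    simp only [one_pow, one_mul]
    rw [mul_neg, ← Finset.prod_mul_distrib, ← Finset.prod_const]
    congr 1
    refine Finset.prod_congr rfl fun k hk => ?_
    have h1 := hR.pole_sub_one (hw k hk)
    have h2 := hR.one_sub_q_mul_ne_zero (hw k hk)
    have h3 := hR.q_mul_sub_one_ne_zero (hw k hk)
    have h4 := hR.one_sub_ne_zero (hw k hk)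
    have h5 : (q : ℂ) ≠ 0 := by exact_mod_cast hR.q_pos.ne'
    rw [hak k hk, ← neg_sub, h1, neg_neg, inv_div]
    field_simp
    ring
  · refine Finset.sum_congr rfl fun k hk => ?_
    have hik : i ≠ k := by rintro rfl; exact hi hk
    rw [Lagrange.nodalWeight, Finset.erase_insert_of_ne hik,
      Finset.prod_insert (fun h => hi (Finset.mem_of_mem_erase h)), hai, hh, poleResidue]
    beta_reduce
    rw [← Finset.mul_prod_erase S _ hk]
    have h1 : ∏ j ∈ S.erase k, scatter p q (pole p q (w k)) (w j) =
        (∏ j ∈ S.erase k, (w j - a k) / (q * w j - 1)) * ∏ j ∈ S.erase k, (a k - a j)⁻¹ := by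
      rw [← Finset.prod_mul_distrib]
      refine Finset.prod_congr rfl fun j hj => ?_
      have hj' := Finset.mem_of_mem_erase hj
      rw [hR.scatter_eq (hw j hj'), hak k hk, hak j hj']
    rw [h1, hak k hk]
    ring

section

variable {ι : Type*} [LinearOrder ι]

theorem prod_incPairs_insert {M : Type*} [CommMonoid M] (g : ι × ι → M) {S : Finset ι} {k : ι}
    (hk : k ∉ S) : ∏ z ∈ incPairs (insert k S), g z =
      (∏ z ∈ incPairs S, g z) * ∏ j ∈ S, if j < k then g (j, k) else g (k, j) := by
  have hinj : InjOn (fun j => if j < k then (j, k) else (k, j)) (S : Set ι) := by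
    intro a ha b hb hab
    have ha' : a ≠ k := by rintro rfl; exact hk ha
    have hb' : b ≠ k := by rintro rfl; exact hk hb
    dsimp only at hab
    split_ifs at hab <;> simp_all
  have hun : incPairs (insert k S) =
      incPairs S ∪ S.image fun j => if j < k then (j, k) else (k, j) := by
    ext ⟨a, b⟩
    simp only [mem_incPairs, Finset.mem_union, Finset.mem_image, Finset.mem_insert]
    constructor
    · rintro ⟨⟨rfl | ha, rfl | hb⟩, hab⟩
      · exact absurd hab (lt_irrefl _)
      · exact Or.inr ⟨b, hb, by rw [if_neg hab.not_gt]⟩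
      · exact Or.inr ⟨a, ha, by rw [if_pos hab]⟩
      · exact Or.inl ⟨⟨ha, hb⟩, hab⟩
    · rintro (⟨⟨ha, hb⟩, hab⟩ | ⟨j, hj, hjk⟩)
      · exact ⟨⟨Or.inr ha, Or.inr hb⟩, hab⟩
      · have hne : j ≠ k := by rintro rfl; exact hk hj
        split_ifs at hjk with hlt <;> obtain ⟨rfl, rfl⟩ := Prod.mk.inj hjk
        · exact ⟨⟨Or.inr hj, Or.inl rfl⟩, hlt⟩
        · exact ⟨⟨Or.inl rfl, Or.inr hj⟩, lt_of_le_of_ne (not_lt.1 hlt) hne.symm⟩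
  rw [hun, Finset.prod_union, Finset.prod_image hinj]
  · congr 1
    exact Finset.prod_congr rfl fun j _ => by split_ifs <;> rfl
  · rw [Finset.disjoint_left]
    rintro ⟨a, b⟩ h1 h2
    simp only [mem_incPairs, Finset.mem_image] at h1 h2
    obtain ⟨j, hj, hjk⟩ := h2
    split_ifs at hjk <;> obtain ⟨rfl, rfl⟩ := Prod.mk.inj hjk
    · exact hk h1.1.2
    · exact hk h1.1.1

theorem wave_insert (p q t : ℝ) (x : ℤ) (Y : ι → ℤ) {S : Finset ι} {k : ι} (hk : k ∉ S)
    (ξ : ι → ℂ) : wave p q t x Y (insert k S) ξ = wave p q t x Y S ξ *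
      (single p q t (x - Y k) (ξ k) *
        ∏ j ∈ S, if j < k then scatter p q (ξ j) (ξ k) else scatter p q (ξ k) (ξ j)) := by
  unfold wave
  rw [prod_incPairs_insert _ hk, Finset.prod_insert hk]
  ring

theorem wave_insert_of_lt (p q t : ℝ) (x : ℤ) (Y : ι → ℤ) {S : Finset ι} {k : ι}
    (hk : ∀ j ∈ S, k < j) (ξ : ι → ℂ) : wave p q t x Y (insert k S) ξ = wave p q t x Y S ξ *
      (single p q t (x - Y k) (ξ k) * ∏ j ∈ S, scatter p q (ξ k) (ξ j)) := by
  rw [wave_insert _ _ _ _ _ fun h => lt_irrefl _ (hk _ h)]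
  congr 2
  exact Finset.prod_congr rfl fun j hj => if_neg (hk j hj).not_gt

theorem wave_update_of_notMem_right (p q t : ℝ) (x : ℤ) (Y : ι → ℤ) {S : Finset ι} {k : ι}
    (hk : k ∉ S) (ξ : ι → ℂ) (z : ℂ) :
    wave p q t x Y S (Function.update ξ k z) = wave p q t x Y S ξ := by
  have h : ∀ j ∈ S, Function.update ξ k z j = ξ j := fun j hj =>
    Function.update_of_ne (by rintro rfl; exact hk hj) _ _
  unfold wave
  congr 1
  · refine Finset.prod_congr rfl fun z hz => ?_
    rw [mem_incPairs] at hz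
    rw [h _ hz.1.1, h _ hz.1.2]
  · exact Finset.prod_congr rfl fun j hj => by rw [h j hj]

theorem single_zero (p q : ℝ) (m : ℤ) (z : ℂ) : single p q 0 m z = z ^ m / (1 - z) := by
  simp [single]

end

end

section

theorem IsLarge.one_le_norm_one_sub {p q R : ℝ} (hR : IsLarge p q R) {z : ℂ} (hz : R ≤ ‖z‖) :
    1 ≤ ‖1 - z‖ := by
  linarith [hR.norm_div_two_le hz, hR.four_le]

section

variable {ι : Type*} [LinearOrder ι] {p q R : ℝ}

theorem IsLarge.norm_prod_scatter_le (hR : IsLarge p q R) (S : Finset ι) {ξ : ι → ℂ}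
    (hξ : ∀ i, R ≤ ‖ξ i‖) : ‖∏ z ∈ incPairs S, scatter p q (ξ z.1) (ξ z.2)‖ ≤ 1 := by
  rw [norm_prod]
  exact Finset.prod_le_one (fun _ _ => norm_nonneg _) fun z _ =>
    hR.norm_scatter_le (hξ _) (hξ _)

theorem IsLarge.norm_wave_zero_le (hR : IsLarge p q R) (x : ℤ) (Y : ι → ℤ) (S : Finset ι)
    {ξ : ι → ℂ} (hξ : ∀ i, R ≤ ‖ξ i‖) :
    ‖wave p q 0 x Y S ξ‖ ≤ ∏ i ∈ S, ‖ξ i‖ ^ (x - Y i) := by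
  rw [wave, norm_mul, ← one_mul (∏ i ∈ S, ‖ξ i‖ ^ (x - Y i))]
  refine mul_le_mul (hR.norm_prod_scatter_le S hξ) ?_ (norm_nonneg _) zero_le_one
  rw [norm_prod]
  refine Finset.prod_le_prod (fun _ _ => norm_nonneg _) fun i _ => ?_
  rw [single_zero, norm_div, norm_zpow]
  exact div_le_self (zpow_nonneg (norm_nonneg _) _) (hR.one_le_norm_one_sub (hξ i))

/-- The two-particle factors of the residue at a pole. -/
def residueScatter (p q : ℝ) (j k : ι) (ξ : ι → ℂ) : ℂ :=
  if j < k then (p * q : ℂ)⁻¹ else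
    -((p * q : ℂ)⁻¹ * (p + q * ξ j * ξ k - ξ j) / (p + q * ξ k * ξ j - ξ k))

/-- The one-particle factor of the residue at a pole. -/
def residueSingle (p q : ℝ) (m : ℕ) (n : ℤ) (w : ℂ) : ℂ :=
  -(pole p q w ^ m) / (pole p q w - 1) * ((w - pole p q w) / (q * w - 1)) * single p q 0 n w

/-- The residue at the pole produced by the `k`-th variable, multiplied by the remaining part of the
integrand. -/
def residueWave (p q : ℝ) (m : ℕ) (x : ℤ) (Y : ι → ℤ) (k : ι) (T : Finset ι) (ξ : ι → ℂ) : ℂ :=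
  residueSingle p q m (x - Y k) (ξ k) * (∏ j ∈ T, residueScatter p q j k ξ) * wave p q 0 x Y T ξ

theorem IsLarge.scatter_pole_mul (hR : IsLarge p q R) (hp : p ≠ 0) {j k : ι} {ξ : ι → ℂ}
    (hξ : ∀ i, R ≤ ‖ξ i‖) (hne : ξ j ≠ ξ k) :
    (scatter p q (pole p q (ξ k)) (ξ j) *
      if j < k then scatter p q (ξ j) (ξ k) else scatter p q (ξ k) (ξ j)) =
      residueScatter p q j k ξ := by
  have h1 := hR.one_sub_q_mul_ne_zero (hξ k)
  have h2 := hR.den_ne_zero (hξ j) (hξ k)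
  have h3 := hR.den_ne_zero (hξ k) (hξ j)
  have h4 : (q : ℂ) ≠ 0 := by exact_mod_cast hR.q_pos.ne'
  have h5 : (p : ℂ) ≠ 0 := by exact_mod_cast hp
  have h6 : ξ j - ξ k ≠ 0 := sub_ne_zero.2 hne
  have h7 : ξ k - ξ j ≠ 0 := sub_ne_zero.2 hne.symm
  have h8 : scatter p q (pole p q (ξ k)) (ξ j) =
      -((p + q * ξ j * ξ k - ξ j) / (p * q * (ξ j - ξ k))) := by
    have e1 : (p : ℂ) + q * pole p q (ξ k) * ξ j - pole p q (ξ k) =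
        p * q * (ξ j - ξ k) / (1 - q * ξ k) := by
      rw [pole]; field_simp; ring
    have e2 : ξ j - pole p q (ξ k) = -(p + q * ξ j * ξ k - ξ j) / (1 - q * ξ k) := by
      rw [pole]; field_simp; ring
    rw [scatter, e1, e2, div_div_div_cancel_right₀ h1, neg_div]
  rw [h8, residueScatter]
  split_ifs
  · rw [scatter, ← neg_sub (ξ j) (ξ k)]
    generalize (p : ℂ) + q * ξ j * ξ k - ξ j = D at *
    field_simp
  · rw [scatter]
    generalize (p : ℂ) + q * ξ k * ξ j - ξ k = D at *
    field_simp

theorem IsLarge.poleResidue_mul_wave (hR : IsLarge p q R) (hp : p ≠ 0) (m : ℕ) (x : ℤ) (Y : ι → ℤ)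
    {S : Finset ι} {k : ι} (hk : k ∈ S) {ξ : ι → ℂ} (hξ : ∀ i, R ≤ ‖ξ i‖)
    (hinj : Function.Injective ξ) :
    poleResidue p q m S ξ k * wave p q 0 x Y S ξ = residueWave p q m x Y k (S.erase k) ξ := by
  conv_lhs => rw [← Finset.insert_erase hk]
  rw [wave_insert _ _ _ _ _ (Finset.notMem_erase k S), poleResidue,
    Finset.erase_insert (Finset.notMem_erase k S), residueWave, residueSingle]
  have : ∏ j ∈ S.erase k, residueScatter p q j k ξ =
      (∏ j ∈ S.erase k, scatter p q (pole p q (ξ k)) (ξ j)) *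
        ∏ j ∈ S.erase k, if j < k then scatter p q (ξ j) (ξ k) else scatter p q (ξ k) (ξ j) := by
    rw [← Finset.prod_mul_distrib]
    exact Finset.prod_congr rfl fun j hj =>
      (hR.scatter_pole_mul hp hξ (hinj.ne (Finset.ne_of_mem_erase hj))).symm
  rw [this]
  ring

theorem IsLarge.norm_residueScatter_le (hR : IsLarge p q R) (hp : p ≠ 0) (j k : ι) {ξ : ι → ℂ}
    (hξ : ∀ i, R ≤ ‖ξ i‖) : ‖residueScatter p q j k ξ‖ ≤ 6 / (p * q ^ 2) := by
  have hp0 : 0 < p := lt_of_le_of_ne hR.p_nonneg hp.symm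
  have hq0 := hR.q_pos
  have hq1 := hR.q_le_one
  have hp1 : p ≤ 1 := by linarith [hR.add_eq]
  have hpq : ‖(p * q : ℂ)⁻¹‖ = (p * q)⁻¹ := by
    rw [norm_inv, norm_mul, Complex.norm_real, Complex.norm_real, Real.norm_of_nonneg hp0.le,
      Real.norm_of_nonneg hq0.le]
  rw [residueScatter]
  split_ifs
  · rw [hpq, inv_eq_one_div, div_le_div_iff₀ (by positivity) (by positivity)]
    have : p * q * q ≤ p * q * 1 := mul_le_mul_of_nonneg_left hq1 (by positivity)
    nlinarith [mul_pos hp0 hq0]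
  · have hj := hR.four_le.trans (hξ j)
    have hk := hR.four_le.trans (hξ k)
    have h1 : ‖(p : ℂ) + q * ξ j * ξ k - ξ j‖ ≤ 3 * (‖ξ k‖ * ‖ξ j‖) := by
      refine (norm_sub_le _ _).trans ((add_le_add_left (norm_add_le _ _) _).trans ?_)
      rw [norm_mul, norm_mul, Complex.norm_real, Complex.norm_real, Real.norm_of_nonneg hp0.le,
        Real.norm_of_nonneg hq0.le]
      have : q * ‖ξ j‖ * ‖ξ k‖ ≤ ‖ξ k‖ * ‖ξ j‖ := by
        rw [mul_assoc, mul_comm ‖ξ j‖]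
        exact mul_le_of_le_one_left (by positivity) hq1
      nlinarith
    have h2 := hR.le_norm_den (hξ k) (hξ j)
    have h3 : 0 < q / 2 * (‖ξ k‖ * ‖ξ j‖) := by positivity
    rw [norm_neg, norm_div, norm_mul, hpq]
    calc (p * q)⁻¹ * ‖(p : ℂ) + q * ξ j * ξ k - ξ j‖ / ‖(p : ℂ) + q * ξ k * ξ j - ξ k‖
        ≤ (p * q)⁻¹ * (3 * (‖ξ k‖ * ‖ξ j‖)) / (q / 2 * (‖ξ k‖ * ‖ξ j‖)) := by gcongr
      _ = 6 / (p * q ^ 2) := by field_simp; norm_num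

theorem IsLarge.norm_residueSingle_le (hR : IsLarge p q R) {m : ℕ} {n : ℤ} (hn : n ≤ m) {w : ℂ}
    (hw : R ≤ ‖w‖) : ‖residueSingle p q m n w‖ ≤ (2 / q) ^ m * (8 / q) / ‖w‖ := by
  have hq0 := hR.q_pos
  have hw4 := hR.four_le.trans hw
  have hw0 : 0 < ‖w‖ := by linarith
  have h1 := hR.one_sub_q_mul_ne_zero hw
  have h2 := hR.one_sub_ne_zero hw
  have h3 := hR.q_mul_sub_one_ne_zero hw
  have h4 : (q : ℂ) ≠ 0 := by exact_mod_cast hq0.ne'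
  obtain ⟨ha1, ha2⟩ := hR.norm_pole_le hw
  have heq : residueSingle p q m n w =
      -(pole p q w ^ m * (w - pole p q w) * w ^ n / (q * (1 - w) * (1 - w))) := by
    have h5 : (pole p q w - 1) * (q * w - 1) = q * (1 - w) := by
      rw [hR.pole_sub_one hw]; field_simp; ring
    rw [residueSingle, single_zero, neg_div, neg_mul, neg_mul, div_mul_div_comm, h5,
      div_mul_div_comm]
  have hd : ‖w‖ / 2 ≤ ‖1 - w‖ := hR.norm_div_two_le hw
  have hs : ‖w - pole p q w‖ ≤ 2 * ‖w‖ := (norm_sub_le _ _).trans (by linarith)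
  have hpow : ‖w‖ ^ n ≤ ‖w‖ ^ m := by
    rw [← zpow_natCast]
    exact zpow_le_zpow_right₀ (by linarith) hn
  rw [heq, norm_neg, norm_div, norm_mul, norm_mul, norm_mul, norm_mul, norm_pow, norm_zpow,
    Complex.norm_real, Real.norm_of_nonneg hq0.le]
  calc ‖pole p q w‖ ^ m * ‖w - pole p q w‖ * ‖w‖ ^ n / (q * ‖1 - w‖ * ‖1 - w‖)
      ≤ (2 / q / ‖w‖) ^ m * (2 * ‖w‖) * ‖w‖ ^ m / (q * (‖w‖ / 2) * (‖w‖ / 2)) := by gcongr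
    _ = (2 / q) ^ m * (8 / q) / ‖w‖ := by
      rw [div_pow (2 / q)]
      field_simp
      norm_num

section

variable [Fintype ι]

theorem IsLarge.holOutside_residueWave (hR : IsLarge p q R) (m : ℕ) (x : ℤ) (Y : ι → ℤ) (k : ι)
    (T : Finset ι) : HolOutside R (residueWave p q m x Y k T) := by
  refine HolOutside.mul (HolOutside.mul ?_ (HolOutside.prod fun j _ => ?_))
    (hR.holOutside_wave 0 x Y T)
  · intro ξ hξ
    have h1 := hR.one_sub_q_mul_ne_zero (hξ k)
    have h2 := hR.q_mul_sub_one_ne_zero (hξ k)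
    have h3 := sub_ne_zero.2 (hR.pole_ne_one (hξ k))
    have h4 := hR.differentiableAt_single 0 (x - Y k) (hξ k)
    have h5 : DifferentiableAt ℂ (pole p q) (ξ k) := by
      unfold pole
      fun_prop (disch := assumption)
    have h6 : DifferentiableAt ℂ (residueSingle p q m (x - Y k)) (ξ k) := by
      unfold residueSingle
      fun_prop (disch := assumption)
    exact DifferentiableAt.comp (f := fun ξ : ι → ℂ => ξ k) ξ h6 (differentiableAt_apply k ξ)
  · intro ξ hξ
    have h1 := hR.den_ne_zero (hξ k) (hξ j)
    unfold residueScatter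
    split_ifs <;> fun_prop (disch := assumption)

theorem IsLarge.integral_residueWave (hR : IsLarge p q R) (hp : p ≠ 0) {m : ℕ} {x : ℤ}
    {Y : ι → ℤ} {k : ι} (hk : x - Y k ≤ m) {T : Finset ι} (hT : k ∉ T) {r : ι → ℝ}
    (hr : ∀ i, R ≤ r i) : ∫ ξ, residueWave p q m x Y k T ξ ∂torusMeasure r = 0 := by
  have h0 := fun i => hR.pos.trans_le (hr i)
  refine integral_torusMeasure_eq_zero (hR.holOutside_residueWave m x Y k T) h0 hr k
    ((2 / q) ^ m * (8 / q) * (6 / (p * q ^ 2)) ^ T.card * ∏ j ∈ T, r j ^ (x - Y j)) ?_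
  intro ξ hξ hξk
  have hξR : ∀ i, R ≤ ‖ξ i‖ := fun i => by
    by_cases hi : i = k
    · subst hi; exact (hr i).trans hξk
    · rw [hξ i hi]; exact hr i
  have hk0 : 0 < ‖ξ k‖ := hR.pos.trans_le (hξR k)
  have h1 := hR.norm_residueSingle_le hk (hξR k)
  have h2 : ‖∏ j ∈ T, residueScatter p q j k ξ‖ ≤ (6 / (p * q ^ 2)) ^ T.card := by
    rw [norm_prod, ← Finset.prod_const]
    exact Finset.prod_le_prod (fun _ _ => norm_nonneg _) fun j _ =>
      hR.norm_residueScatter_le hp j k hξR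
  have h3 : ‖wave p q 0 x Y T ξ‖ ≤ ∏ j ∈ T, r j ^ (x - Y j) := by
    refine (hR.norm_wave_zero_le x Y T hξR).trans_eq ?_
    exact Finset.prod_congr rfl fun j hj => by rw [hξ j (by rintro rfl; exact hT hj)]
  rw [residueWave, norm_mul, norm_mul]
  have hq0 := hR.q_pos
  have hp0 := hR.p_nonneg
  calc _ ≤ (2 / q) ^ m * (8 / q) / ‖ξ k‖ * (6 / (p * q ^ 2)) ^ T.card *
        ∏ j ∈ T, r j ^ (x - Y j) := by gcongr
    _ = _ := by ring

/-- At time `0` the index sets with the left-most particle are related to those without. -/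
theorem IsLarge.waveIntegral_insert (hR : IsLarge p q R) {x : ℤ} {Y : ι → ℤ} {i : ι} {S : Finset ι}
    (hi : ∀ k ∈ S, i < k) (hY : ∀ k ∈ S, Y i < Y k) (hx : Y i < x) (hp : ∀ k ∈ S, p ≠ 0) :
    waveIntegral p q 0 x R Y (insert i S) = -(q⁻¹ : ℂ) ^ S.card * waveIntegral p q 0 x R Y S := by
  have hiS : i ∉ S := fun h => lt_irrefl _ (hi i h)
  obtain ⟨m, hm⟩ : ∃ m : ℕ, x - Y i = (m + 1 : ℕ) := ⟨(x - Y i - 1).toNat, by omega⟩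
  set r : ι → ℝ := fun j => R + (Fintype.equivFin ι j : ℕ) with hr
  have hrR : ∀ j, R ≤ r j := fun j => by simp [hr]
  have hr0 : ∀ j, 0 < r j := fun j => hR.pos.trans_le (hrR j)
  have hrinj : Function.Injective r := fun a b hab =>
    (Fintype.equivFin ι).injective (Fin.ext (by simpa [hr] using hab))
  have hupd : Function.update r i (r i) = r := Function.update_eq_self i r
  unfold waveIntegral
  rw [← integral_torusMeasure_eq (hR.holOutside_wave 0 x Y S) (fun _ => hR.pos) (fun _ => le_rfl)
      hrR, ← integral_torusMeasure_eq (hR.holOutside_wave 0 x Y (insert i S)) (fun _ => hR.pos)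
      (fun _ => le_rfl) hrR, ← hupd, integral_torusMeasure_update i (by rw [hupd]; exact
      fun j => (hr0 j).le) ((hR.holOutside_wave 0 x Y _).continuousOn (by rw [hupd]; exact hrR)),
    hupd]
  have hinner : ∀ ξ ∈ torus r,
      ∫ z, wave p q 0 x Y (insert i S) (Function.update ξ i z) ∂circleMeasure (r i) =
        -(q⁻¹ : ℂ) ^ S.card * wave p q 0 x Y S ξ +
          ∑ k ∈ S, residueWave p q m x Y k (S.erase k) ξ := by
    intro ξ hξ
    have hξR : ∀ j, R ≤ ‖ξ j‖ := fun j => (hrR j).trans (hξ j).ge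
    have hξinj : Function.Injective ξ := fun a b hab => hrinj (by rw [← hξ a, ← hξ b, hab])
    have hw : ∀ z, wave p q 0 x Y (insert i S) (Function.update ξ i z) =
        wave p q 0 x Y S ξ * (z ^ (m + 1) / (1 - z) * ∏ k ∈ S, scatter p q z (ξ k)) := by
      intro z
      rw [wave_insert_of_lt _ _ _ _ _ hi, wave_update_of_notMem_right _ _ _ _ _ hiS, single_zero,
        Function.update_self, hm, zpow_natCast]
      congr 2
      exact Finset.prod_congr rfl fun k hk => by
        rw [Function.update_of_ne (by rintro rfl; exact hiS hk)]
    simp only [hw]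
    rw [integral_const_mul, integral_circleMeasure (hr0 i).le,
      hR.circleAverage_prod_scatter hp (fun k _ => hξR k) hξinj.injOn (hrR i) m hiS, mul_add,
      mul_comm, Finset.mul_sum]
    · congr 1
      refine Finset.sum_congr rfl fun k hk => ?_
      rw [mul_comm, hR.poleResidue_mul_wave (hp k hk) m x Y hk hξR hξinj]
    · intro z hz
      have hzR : R ≤ ‖z‖ := by
        rw [mem_sphere_zero_iff_norm] at hz
        exact (hrR i).trans hz.ge
      have h1 := hR.one_sub_ne_zero hzR
      refine ContinuousAt.continuousWithinAt (ContinuousAt.mul (by fun_prop (disch := assumption))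
        (tendsto_finsetProd _ fun k _ => ?_))
      have h2 := hR.den_ne_zero hzR (hξR k)
      unfold scatter
      exact ContinuousAt.tendsto (f := fun z => (ξ k - z) / (p + q * z * ξ k - z))
        (by fun_prop (disch := assumption))
  rw [integral_congr_ae ((ae_torusMeasure fun j => (hr0 j).le).mono hinner), integral_add,
    integral_const_mul, integral_finsetSum, Finset.sum_eq_zero, add_zero]
  · intro k hk
    exact hR.integral_residueWave (hp k hk) (by have := hY k hk; omega) (Finset.notMem_erase k S) hrR
  · intro k _
    exact integrable_torusMeasure (fun j => (hr0 j).le)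
      ((hR.holOutside_residueWave m x Y k _).continuousOn hrR)
  · exact (integrable_torusMeasure (fun j => (hr0 j).le)
      ((hR.holOutside_wave 0 x Y S).continuousOn hrR)).const_mul _
  · exact integrable_finsetSum _ fun k _ => integrable_torusMeasure (fun j => (hr0 j).le)
      ((hR.holOutside_residueWave m x Y k _).continuousOn hrR)

theorem IsLarge.waveIntegral_zero_of_le (hR : IsLarge p q R) {x : ℤ} {Y : ι → ℤ} {S : Finset ι}
    (hS : S.Nonempty) (hx : ∀ i ∈ S, x ≤ Y i) : waveIntegral p q 0 x R Y S = 0 := by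
  obtain ⟨i, hi⟩ := hS
  refine integral_torusMeasure_eq_zero (hR.holOutside_wave 0 x Y S) (fun _ => hR.pos)
    (fun _ => le_rfl) i 2 fun ξ hξ hξi => ?_
  have hξR : ∀ j, R ≤ ‖ξ j‖ := fun j => by
    by_cases hj : j = i
    · subst hj; exact hξi
    · exact (hξ j hj).ge
  have h1 : ∀ j ∈ S, ‖single p q 0 (x - Y j) (ξ j)‖ ≤ 2 / ‖ξ j‖ := by
    intro j hj
    have h4 := hR.four_le.trans (hξR j)
    rw [single_zero, norm_div, norm_zpow]
    calc ‖ξ j‖ ^ (x - Y j) / ‖1 - ξ j‖ ≤ 1 / (‖ξ j‖ / 2) := by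
          have := hR.norm_div_two_le (hξR j)
          have : ‖ξ j‖ ^ (x - Y j) ≤ 1 :=
            zpow_le_one_of_nonpos₀ (by linarith) (by linarith [hx j hj])
          gcongr
      _ = 2 / ‖ξ j‖ := by field_simp
  rw [wave, norm_mul, ← one_mul (2 / ‖ξ i‖)]
  refine mul_le_mul (hR.norm_prod_scatter_le S hξR) ?_ (norm_nonneg _) zero_le_one
  rw [norm_prod, ← Finset.mul_prod_erase S _ hi, ← mul_one (2 / ‖ξ i‖)]
  refine mul_le_mul (h1 i hi) (Finset.prod_le_one (fun _ _ => norm_nonneg _) fun j hj => ?_)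
    (Finset.prod_nonneg fun _ _ => norm_nonneg _) (by positivity)
  have h4 := hR.four_le.trans (hξR j)
  exact (h1 j (Finset.mem_of_mem_erase hj)).trans (div_le_one_of_le₀ (by linarith) (by linarith))

theorem waveIntegral_empty (p q t : ℝ) (x : ℤ) (R : ℝ) (Y : ι → ℤ) :
    waveIntegral p q t x R Y ∅ = 1 := by
  simp [waveIntegral, wave, incPairs]

end

end

variable {N : ℕ} {p q R : ℝ}

@[simp] theorem weight_empty : weight p q (∅ : Finset (Fin N)) = 1 := by simp [weight]

theorem weight_insert_zero (hq : q ≠ 0) (hN : 0 < N) {S : Finset (Fin N)}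
    (hS : (⟨0, hN⟩ : Fin N) ∉ S) :
    weight p q (insert ⟨0, hN⟩ S) = weight p q S * q ^ S.card := by
  unfold weight
  rw [Finset.prod_insert hS, Finset.card_insert_of_notMem hS,
    show (S.card + 1 + 1).choose 2 = (S.card + 1) + (S.card + 1).choose 2 by
      rw [Nat.choose_succ_succ' (S.card + 1) 1, Nat.choose_one_right]]
  simp only [pow_zero, zero_add, pow_one, one_mul, pow_add]
  field_simp

theorem weight_eq_zero (hp : p = 0) (hN : 0 < N) {S : Finset (Fin N)} (hS : S.Nonempty)
    (h0 : (⟨0, hN⟩ : Fin N) ∉ S) : weight p q S = 0 := by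
  obtain ⟨i, hi⟩ := hS
  have : (i : ℕ) ≠ 0 := fun h => h0 (by convert hi; exact h.symm)
  unfold weight
  rw [Finset.prod_eq_zero hi (by rw [hp, zero_pow this, zero_mul]), zero_mul]

/-- The initial condition. -/
theorem IsLarge.tailFormula_zero (hR : IsLarge p q R) (hN : 0 < N) (x : ℤ) {Y : Fin N → ℤ}
    (hY : StrictMono Y) : tailFormula p q 0 x R Y = if x ≤ Y ⟨0, hN⟩ then 1 else 0 := by
  have hle : ∀ i : Fin N, (⟨0, hN⟩ : Fin N) ≤ i := fun i => Fin.mk_le_of_le_val (Nat.zero_le _)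
  unfold tailFormula
  split_ifs with hx
  · rw [Finset.sum_eq_single ∅]
    · simp [waveIntegral_empty]
    · intro S _ hS
      rw [hR.waveIntegral_zero_of_le (Finset.nonempty_iff_ne_empty.2 hS) fun i _ =>
        hx.trans (hY.monotone (hle i)), mul_zero]
    · simp
  · push Not at hx
    rw [← Finset.powerset_univ, ← Finset.insert_erase (Finset.mem_univ (⟨0, hN⟩ : Fin N)),
      Finset.sum_powerset_insert (Finset.notMem_erase _ _), ← Finset.sum_add_distrib]
    refine Finset.sum_eq_zero fun S hS => ?_
    have h0 : (⟨0, hN⟩ : Fin N) ∉ S := fun h =>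
      Finset.notMem_erase _ _ (Finset.mem_powerset.1 hS h)
    have hlt : ∀ k ∈ S, (⟨0, hN⟩ : Fin N) < k := fun k hk =>
      lt_of_le_of_ne (hle k) (by rintro rfl; exact h0 hk)
    have hq : (q : ℂ) ≠ 0 := by exact_mod_cast hR.q_pos.ne'
    rw [weight_insert_zero hR.q_pos.ne' hN h0]
    by_cases hp : p = 0 ∧ S.Nonempty
    · rw [weight_eq_zero hp.1 hN hp.2 h0]; simp
    · rw [hR.waveIntegral_insert hlt (fun k hk => hY (hlt k hk)) hx
        fun k hk hp0 => hp ⟨hp0, k, hk⟩]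
      push_cast
      have : (q : ℂ) ^ S.card * (q⁻¹ : ℂ) ^ S.card = 1 := by
        rw [← mul_pow, mul_inv_cancel₀ hq, one_pow]
      linear_combination (-(weight p q S : ℂ) * waveIntegral p q 0 x R Y S) * this

end

section

section

variable {ι : Type*} [LinearOrder ι] {p q R : ℝ}

theorem IsLarge.norm_eps_le (hR : IsLarge p q R) {z : ℂ} (hz : ‖z‖ = R) :
    ‖eps p q z‖ ≤ R + 2 := by
  have h1 := hR.four_le
  have hp : p ≤ 1 := by linarith [hR.q_pos, hR.add_eq]
  refine (norm_sub_le _ _).trans ((add_le_add_left (norm_add_le _ _) _).trans ?_)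
  rw [norm_mul, norm_mul, norm_inv, Complex.norm_real, Complex.norm_real,
    Real.norm_of_nonneg hR.p_nonneg, Real.norm_of_nonneg hR.q_pos.le, hz, norm_one]
  have h2 : p * R⁻¹ ≤ 1 * 1 := by
    have : R⁻¹ ≤ 1 := inv_le_one_of_one_le₀ (by linarith)
    have := hR.pos
    gcongr
  have h3 : q * R ≤ R := mul_le_of_le_one_left hR.pos.le hR.q_le_one
  linarith

theorem IsLarge.norm_single_le (hR : IsLarge p q R) {t : ℝ} (ht : 0 ≤ t) (m : ℤ) {z : ℂ}
    (hz : ‖z‖ = R) : ‖single p q t m z‖ ≤ Real.exp ((R + 2) * t) * R ^ m := by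
  have h1 : ‖Complex.exp (eps p q z * t)‖ ≤ Real.exp ((R + 2) * t) := by
    rw [Complex.norm_exp]
    refine Real.exp_le_exp.2 ((Complex.re_le_norm _).trans ?_)
    rw [norm_mul, Complex.norm_real, Real.norm_of_nonneg ht]
    exact mul_le_mul_of_nonneg_right (hR.norm_eps_le hz) ht
  have h2 : ‖z ^ m / (1 - z)‖ ≤ R ^ m := by
    rw [norm_div, norm_zpow, hz]
    exact div_le_self (zpow_nonneg hR.pos.le _) (hR.one_le_norm_one_sub hz.ge)
  rw [single, norm_mul, mul_comm]
  have := hR.pos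
  gcongr

theorem IsLarge.norm_waveIntegral_le [Fintype ι] (hR : IsLarge p q R) {t : ℝ} (ht : 0 ≤ t) (x : ℤ)
    (Y : ι → ℤ) (S : Finset ι) : ‖waveIntegral p q t x R Y S‖ ≤
      ∏ i ∈ S, (Real.exp ((R + 2) * t) * R ^ (x - Y i)) := by
  refine norm_integral_torusMeasure_le (fun _ => hR.pos.le) fun ξ hξ => ?_
  rw [wave, norm_mul, ← one_mul (∏ i ∈ S, (Real.exp ((R + 2) * t) * R ^ (x - Y i)))]
  refine mul_le_mul (hR.norm_prod_scatter_le S fun i => (hξ i).ge) ?_ (norm_nonneg _) zero_le_one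
  rw [norm_prod]
  exact Finset.prod_le_prod (fun _ _ => norm_nonneg _) fun i _ => hR.norm_single_le ht _ (hξ i)

end

variable {N : ℕ} {p q R : ℝ}

theorem jumpRight_eq (i : Fin N) (η : Config N) :
    (jumpRight i η).1 = η.1 ∨ (jumpRight i η).1 = Function.update η.1 i (η.1 i + 1) := by
  unfold jumpRight
  split_ifs
  · exact Or.inr rfl
  · exact Or.inl rfl

theorem jumpLeft_eq (i : Fin N) (η : Config N) :
    (jumpLeft i η).1 = η.1 ∨ (jumpLeft i η).1 = Function.update η.1 i (η.1 i + -1) := by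
  unfold jumpLeft
  split_ifs
  · exact Or.inr rfl
  · exact Or.inl rfl

/-- A weight on configurations that a jump multiplies by at most `R`. -/
def growth (R : ℝ) (x : ℤ) (Y : Fin N → ℤ) : ℝ := ∏ i, R ^ (x - Y i).natAbs

theorem one_le_growth (hR : 1 ≤ R) (x : ℤ) (Y : Fin N → ℤ) : 1 ≤ growth R x Y := by
  unfold growth
  exact Finset.prod_induction _ (1 ≤ ·) (fun _ _ => one_le_mul_of_one_le_of_one_le) le_rfl
    fun i _ => one_le_pow₀ hR

theorem growth_update_le (hR : 1 ≤ R) (x : ℤ) (Y : Fin N → ℤ) (i : Fin N) {d : ℤ}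
    (hd : d = 1 ∨ d = -1) :
    growth R x (Function.update Y i (Y i + d)) ≤ R * growth R x Y := by
  unfold growth
  rw [← Finset.mul_prod_erase _ _ (Finset.mem_univ i),
    ← Finset.mul_prod_erase _ (fun i => R ^ (x - Y i).natAbs) (Finset.mem_univ i), ← mul_assoc,
    ← pow_succ', Function.update_self]
  have h1 : ∏ j ∈ Finset.univ.erase i, R ^ (x - Function.update Y i (Y i + d) j).natAbs =
      ∏ j ∈ Finset.univ.erase i, R ^ (x - Y j).natAbs :=
    Finset.prod_congr rfl fun j hj => by rw [Function.update_of_ne (Finset.ne_of_mem_erase hj)]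
  rw [h1]
  refine mul_le_mul_of_nonneg_right (pow_le_pow_right₀ hR ?_)
    (Finset.prod_nonneg fun _ _ => by positivity)
  omega

theorem growth_jumpRight_le (hR : 1 ≤ R) (x : ℤ) (η : Config N) (i : Fin N) :
    growth R x (jumpRight i η).1 ≤ R * growth R x η.1 := by
  rcases jumpRight_eq i η with h | h <;> rw [h]
  · exact le_mul_of_one_le_left (zero_le_one.trans (one_le_growth hR x η.1)) hR
  · exact growth_update_le hR x η.1 i (Or.inl rfl)

theorem growth_jumpLeft_le (hR : 1 ≤ R) (x : ℤ) (η : Config N) (i : Fin N) :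
    growth R x (jumpLeft i η).1 ≤ R * growth R x η.1 := by
  rcases jumpLeft_eq i η with h | h <;> rw [h]
  · exact le_mul_of_one_le_left (zero_le_one.trans (one_le_growth hR x η.1)) hR
  · exact growth_update_le hR x η.1 i (Or.inr rfl)

/-- Uniqueness of solutions of the backward equation of controlled growth. -/
theorem eq_zero_of_backward_equation (hp : 0 ≤ p) (hq : 0 ≤ q) (hpq : p + q = 1) (hR : 1 ≤ R)
    (x : ℤ) {V : ℝ → Config N → ℂ} (h0 : ∀ η, V 0 η = 0)
    (hV : ∀ t η, HasDerivAt (fun t => V t η)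
      (∑ i, (p * (V t (jumpRight i η) - V t η) + q * (V t (jumpLeft i η) - V t η))) t)
    {T C : ℝ} (hT : 0 ≤ T) (hC : ∀ t ∈ Icc 0 T, ∀ η, ‖V t η‖ ≤ C * growth R x η.1) (η : Config N) :
    V T η = 0 := by
  set K : ℝ := N * (R + 1) with hK
  have hiter : ∀ n : ℕ, ∀ t ∈ Icc 0 T, ∀ η,
      ‖V t η‖ ≤ C * growth R x η.1 * ((K * t) ^ n / n.factorial) := by
    intro n
    induction n with
    | zero => simpa using hC
    | succ n ih =>
      intro t ht η
      refine image_norm_le_of_norm_deriv_right_le_deriv_boundary (f := fun t => V t η)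
        (f' := fun t => ∑ i, (p * (V t (jumpRight i η) - V t η) + q * (V t (jumpLeft i η) - V t η)))
        (B := fun t => C * growth R x η.1 * ((K * t) ^ (n + 1) / (n + 1).factorial))
        (B' := fun t => K * (C * growth R x η.1 * ((K * t) ^ n / n.factorial)))
        (fun s _ => (hV s η).continuousAt.continuousWithinAt)
        (fun s _ => (hV s η).hasDerivWithinAt) (by simp [h0]) ?_ ?_ ht
      · intro s
        have h1 := ((((hasDerivAt_id s).const_mul K).pow (n + 1)).div_const
          ((n + 1).factorial : ℝ)).const_mul (C * growth R x η.1)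
        refine h1.congr_deriv ?_
        have h2 : ((n + 1 : ℕ) : ℝ) ≠ 0 := by positivity
        have h3 : (n.factorial : ℝ) ≠ 0 := by positivity
        rw [Nat.factorial_succ]
        simp only [id, Nat.add_sub_cancel, mul_one]
        push_cast at h2 ⊢
        field_simp
      · intro s hs
        have hs' : s ∈ Icc 0 T := ⟨hs.1, hs.2.le⟩
        set D := C * growth R x η.1 * ((K * s) ^ n / n.factorial) with hD
        have hKs : 0 ≤ (K * s) ^ n / n.factorial := by
          have := hs.1
          positivity
        have hC0 : 0 ≤ C := by
          have h1 := (norm_nonneg _).trans (hC s hs' η)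
          exact nonneg_of_mul_nonneg_left h1 (zero_lt_one.trans_le (one_le_growth hR x η.1))
        have hb := ih s hs' η
        have hjump : ∀ η' : Config N, growth R x η'.1 ≤ R * growth R x η.1 → ‖V s η'‖ ≤ R * D := by
          intro η' hη'
          refine (ih s hs' η').trans ?_
          calc C * growth R x η'.1 * ((K * s) ^ n / n.factorial)
              ≤ C * (R * growth R x η.1) * ((K * s) ^ n / n.factorial) := by gcongr
            _ = R * D := by rw [hD]; ring
        have hsub : ∀ η' : Config N, growth R x η'.1 ≤ R * growth R x η.1 →
            ‖V s η' - V s η‖ ≤ (R + 1) * D := fun η' hη' =>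
          (norm_sub_le _ _).trans (by linarith [hjump η' hη'])
        refine (norm_sum_le _ _).trans ((Finset.sum_le_card_nsmul _ _ ((R + 1) * D) fun i _ => ?_).trans
          (by simp [hK, mul_assoc]))
        refine (norm_add_le _ _).trans ?_
        rw [norm_mul, norm_mul, Complex.norm_real, Complex.norm_real, Real.norm_of_nonneg hp,
          Real.norm_of_nonneg hq]
        calc p * ‖V s (jumpRight i η) - V s η‖ + q * ‖V s (jumpLeft i η) - V s η‖
            ≤ p * ((R + 1) * D) + q * ((R + 1) * D) := by
              gcongr
              · exact hsub _ (growth_jumpRight_le hR x η i)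
              · exact hsub _ (growth_jumpLeft_le hR x η i)
          _ = (R + 1) * D := by rw [← add_mul, hpq, one_mul]
  have hlim := (FloorSemiring.tendsto_pow_div_factorial_atTop (K * T)).const_mul
    (C * growth R x η.1)
  rw [mul_zero] at hlim
  have := ge_of_tendsto' hlim fun n => hiter n T ⟨hT, le_rfl⟩ η
  exact norm_le_zero_iff.1 this

theorem IsLarge.norm_tailFormula_le (hR : IsLarge p q R) {T : ℝ} (x : ℤ) :
    ∃ C, ∀ t ∈ Icc 0 T, ∀ Y : Fin N → ℤ, ‖tailFormula p q t x R Y‖ ≤ C * growth R x Y := by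
  have hR1 : 1 ≤ R := by linarith [hR.four_le]
  refine ⟨∑ S : Finset (Fin N), |weight p q S| * Real.exp ((R + 2) * T) ^ S.card, fun t ht Y => ?_⟩
  unfold tailFormula
  rw [Finset.sum_mul]
  refine (norm_sum_le _ _).trans (Finset.sum_le_sum fun S _ => ?_)
  rw [norm_mul, Complex.norm_real, Real.norm_eq_abs, mul_assoc]
  refine mul_le_mul_of_nonneg_left ((hR.norm_waveIntegral_le ht.1 x Y S).trans ?_) (abs_nonneg _)
  have hR0 := hR.pos
  rw [Finset.prod_mul_distrib, Finset.prod_const]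
  refine mul_le_mul (pow_le_pow_left₀ (Real.exp_pos _).le
    (Real.exp_le_exp.2 (mul_le_mul_of_nonneg_left ht.2 (by linarith))) _) ?_
    (Finset.prod_nonneg fun _ _ => by positivity) (by positivity)
  calc ∏ i ∈ S, R ^ (x - Y i) ≤ ∏ i ∈ S, R ^ (x - Y i).natAbs := by
        refine Finset.prod_le_prod (fun _ _ => by positivity) fun i _ => ?_
        rw [← zpow_natCast]
        exact zpow_le_zpow_right₀ hR1 Int.le_natAbs
    _ ≤ growth R x Y := by
        rw [growth, ← Finset.prod_sdiff (Finset.subset_univ S)]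
        exact le_mul_of_one_le_left (Finset.prod_nonneg fun _ _ => by positivity)
          (Finset.prod_induction _ (1 ≤ ·) (fun _ _ => one_le_mul_of_one_le_of_one_le) le_rfl
            fun i _ => one_le_pow₀ hR1)

theorem hasDerivAt_semigroup (p q t : ℝ) (f : Obs N) (η : Config N) :
    HasDerivAt (fun t => semigroup N p q t f η)
      (∑ i, (p * (semigroup N p q t f (jumpRight i η) - semigroup N p q t f η) +
        q * (semigroup N p q t f (jumpLeft i η) - semigroup N p q t f η))) t := by
  have h1 : HasDerivAt (fun t => semigroup N p q t)
      (generator N p q * semigroup N p q t) t := hasDerivAt_exp_smul_const' (generator N p q) t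
  have h2 : HasDerivAt (fun t => semigroup N p q t f)
      ((generator N p q * semigroup N p q t) f) t := by
    simpa using h1.clm_apply (hasDerivAt_const t f)
  have h3 := (lp.evalCLM ℝ (fun _ : Config N => ℝ) ⊤ η).hasFDerivAt.comp_hasDerivAt t h2
  refine h3.congr_deriv ?_
  rw [← generator_apply]
  rfl

theorem exists_norm_semigroup_le (p q T : ℝ) (f : Obs N) :
    ∃ C, 0 ≤ C ∧ ∀ t ∈ Icc 0 T, ∀ η, |semigroup N p q t f η| ≤ C := by
  have h1 : Continuous fun t => semigroup N p q t f := by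
    have h : Continuous fun t => semigroup N p q t := continuous_iff_continuousAt.2 fun t =>
      (hasDerivAt_exp_smul_const' (𝕂 := ℝ) (generator N p q) t).continuousAt
    exact h.clm_apply continuous_const
  obtain ⟨C, hC⟩ := isCompact_Icc.exists_bound_of_continuousOn (s := Icc 0 T) h1.continuousOn
  exact ⟨max C 0, le_max_right _ _, fun t ht η =>
    (lp.norm_apply_le_norm ENNReal.top_ne_zero (semigroup N p q t f) η).trans
      ((hC t ht).trans (le_max_left _ _))⟩

theorem semigroup_zero_apply (p q : ℝ) (f : Obs N) : semigroup N p q 0 f = f := by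
  have h : semigroup N p q 0 = 1 :=
    (congrArg NormedSpace.exp (zero_smul ℝ (generator N p q))).trans NormedSpace.exp_zero
  rw [h]
  rfl

theorem indicatorFn_apply (A : Set (Config N)) (η : Config N) :
    indicatorFn A η = A.indicator (fun _ => (1 : ℝ)) η := rfl

/-- The distribution of the left-most particle. -/
theorem IsLarge.prob_le_eq (hR : IsLarge p q R) (hN : 0 < N) {t : ℝ} (ht : 0 ≤ t) (x : ℤ)
    (Y : Config N) :
    (prob p q t Y {η | x ≤ η.1 ⟨0, hN⟩} : ℂ) = tailFormula p q t x R Y.1 := by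
  have hR1 : 1 ≤ R := by linarith [hR.four_le]
  set f : Obs N := indicatorFn {η | x ≤ η.1 ⟨0, hN⟩} with hf
  obtain ⟨C₁, hC₁⟩ := hR.norm_tailFormula_le (N := N) (T := t) x
  obtain ⟨C₂, hC₂0, hC₂⟩ := exists_norm_semigroup_le p q t f
  have key := eq_zero_of_backward_equation hR.p_nonneg hR.q_pos.le hR.add_eq hR1 x
    (V := fun s η => tailFormula p q s x R η.1 - (semigroup N p q s f η : ℂ)) (T := t)
    (C := C₁ + C₂) ?_ ?_ ht ?_ Y
  · exact (sub_eq_zero.1 key).symm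
  · intro η
    have : semigroup N p q 0 f η = if x ≤ η.1 ⟨0, hN⟩ then 1 else 0 := by
      rw [semigroup_zero_apply, hf, indicatorFn_apply]
      split_ifs with h
      · exact Set.indicator_of_mem (s := {η : Config N | x ≤ η.1 ⟨0, hN⟩}) h (fun _ => (1 : ℝ))
      · exact Set.indicator_of_notMem (s := {η : Config N | x ≤ η.1 ⟨0, hN⟩}) h (fun _ => (1 : ℝ))
    simp only [this, hR.tailFormula_zero hN x η.2]
    split_ifs <;> simp
  · intro s η
    refine ((hR.hasDerivAt_tailFormula_config s x η).sub
      (hasDerivAt_semigroup p q s f η).ofReal_comp).congr_deriv ?_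
    push_cast
    rw [← Finset.sum_sub_distrib]
    exact Finset.sum_congr rfl fun i _ => by ring
  · intro s hs η
    refine (norm_sub_le _ _).trans ?_
    rw [add_mul, Complex.norm_real]
    exact add_le_add (hC₁ s hs η.1)
      ((hC₂ s hs η).trans (le_mul_of_one_le_right hC₂0 (one_le_growth hR1 x η.1)))

theorem IsLarge.probFirst_eq (hR : IsLarge p q R) (hN : 0 < N) {t : ℝ} (ht : 0 ≤ t) (x : ℤ)
    (Y : Config N) :
    (probFirst hN p q t Y x : ℂ) = tailFormula p q t x R Y.1 - tailFormula p q t (x + 1) R Y.1 := by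
  rw [← hR.prob_le_eq hN ht, ← hR.prob_le_eq hN ht, ← Complex.ofReal_sub]
  congr 1
  have : (indicatorFn {η : Config N | η.1 ⟨0, hN⟩ = x}) =
      indicatorFn {η | x ≤ η.1 ⟨0, hN⟩} - indicatorFn {η | x + 1 ≤ η.1 ⟨0, hN⟩} := by
    ext η
    rw [lp.coeFn_sub, Pi.sub_apply]
    simp only [indicatorFn_apply, Set.indicator_apply, mem_ofPred_eq]
    split_ifs <;> first | omega | simp
  rw [probFirst, prob, prob, prob, this, map_sub]
  rfl

end

section

variable {p q R : ℝ}

theorem PolesInside.one_lt {n : ℕ} (hn : 0 < n) (h : PolesInside p q R n) : 1 < R := by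
  by_contra! hR
  exact (h (fun _ => 1) (fun _ => by simpa using hR)).2.1 ⟨0, hn⟩ (sub_self 1)

theorem PolesInside.mono {n N : ℕ} (hnN : n ≤ N) (h : PolesInside p q R N) :
    PolesInside p q R n := by
  intro ξ hξ
  obtain ⟨h1, h2, h3⟩ := h (fun i => if hi : (i : ℕ) < n then ξ ⟨i, hi⟩ else (R : ℂ)) (by
    intro i
    split_ifs
    · exact hξ _
    · rw [Complex.norm_real]; exact le_abs_self R)
  refine ⟨fun i => by simpa using h1 (Fin.castLE hnN i), fun i => by
    simpa using h2 (Fin.castLE hnN i), fun i j hij => ?_⟩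
  simpa using h3 (Fin.castLE hnN i) (Fin.castLE hnN j) hij

theorem holOutside_integrand {n : ℕ} (h : PolesInside p q R n) (t : ℝ) (x : ℤ) (y : Fin n → ℤ) :
    HolOutside R (integrand p q t x y) := by
  refine HolOutside.mul (HolOutside.mul (HolOutside.prod fun i _ => HolOutside.prod fun j hj => ?_)
    ?_) (HolOutside.prod fun i _ => ?_)
  · intro ξ hξ
    have := (h ξ hξ).2.2 i j (Finset.mem_Ioi.1 hj)
    fun_prop (disch := assumption)
  · intro ξ hξ
    have hprod : ∀ F : Fin n → (Fin n → ℂ) → ℂ, (∀ i, HolOutside R (F i)) →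
        DifferentiableAt ℂ (fun ξ => ∏ i, F i ξ) ξ := fun F hF =>
      (HolOutside.prod fun i _ => hF i) ξ hξ
    have h1 := hprod (fun i ξ => ξ i) fun i ξ _ => by fun_prop
    have h2 := hprod (fun i ξ => 1 - ξ i) fun i ξ _ => by fun_prop
    have h3 : ∏ i, (1 - ξ i) ≠ 0 := Finset.prod_ne_zero_iff.2 fun i _ => (h ξ hξ).2.1 i
    fun_prop (disch := assumption)
  · intro ξ hξ
    have h0 := (h ξ hξ).1 i
    have h1 : DifferentiableAt ℂ (fun ξ : Fin n → ℂ => ξ i) ξ := by fun_prop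
    have h2 : DifferentiableAt ℂ (fun ξ : Fin n → ℂ => eps p q (ξ i)) ξ :=
      DifferentiableAt.comp (f := fun ξ : Fin n → ℂ => ξ i) ξ (differentiableAt_eps h0) h1
    exact (h1.zpow (Or.inl h0)).mul (h2.mul_const _).cexp

/-- The contributions do not depend on the radius. -/
theorem contribution_eq_of_le (hR : 1 < R) {R' : ℝ} (hRR' : R ≤ R') {S : Finset ℕ}
    (h : PolesInside p q R S.card) (t : ℝ) (x : ℤ) (y : ℕ → ℤ) :
    contribution p q t x y R' S = contribution p q t x y R S := by
  have hol := holOutside_integrand h t x (subConfig y S)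
  have hR0 : 0 < R := by linarith
  unfold contribution
  rw [contourIntegral_eq_integral hR0.le (hol.continuousOn fun _ => le_rfl),
    contourIntegral_eq_integral (hR0.trans_le hRR').le (hol.continuousOn fun _ => hRR'),
    integral_torusMeasure_eq (hol.mul (HolOutside.prod fun i _ _ _ => by fun_prop))
      (fun _ => hR0) (fun _ => le_rfl) fun _ => hRR']

theorem IsLarge.polesInside (hR : IsLarge p q R) (n : ℕ) : PolesInside p q R n := fun _ hξ =>
  ⟨fun i => hR.ne_zero (hξ i), fun i => hR.one_sub_ne_zero (hξ i),
    fun i j _ => hR.den_ne_zero (hξ i) (hξ j)⟩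

theorem integrand_mul_prod_eq {n : ℕ} (t : ℝ) (x : ℤ) (y : Fin n → ℤ) {ξ : Fin n → ℂ}
    (hξ : ∀ i, ξ i ≠ 0) : integrand p q t x y ξ * ∏ i, ξ i =
      wave p q t x y Finset.univ ξ - wave p q t (x + 1) y Finset.univ ξ := by
  have h1 : ∏ i, ∏ j ∈ Finset.Ioi i, (ξ j - ξ i) / (p + q * ξ i * ξ j - ξ i) =
      ∏ z ∈ incPairs (Finset.univ : Finset (Fin n)), scatter p q (ξ z.1) (ξ z.2) :=
    (Finset.prod_finset_product' _ _ _ (by simp)).symm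
  have h2 : ∏ i, single p q t (x + 1 - y i) (ξ i) =
      (∏ i, ξ i) * ∏ i, single p q t (x - y i) (ξ i) := by
    rw [← Finset.prod_mul_distrib]
    refine Finset.prod_congr rfl fun i _ => ?_
    unfold single
    rw [show x + 1 - y i = 1 + (x - y i) by ring, zpow_add₀ (hξ i), zpow_one]
    ring
  have h3 : ∏ i, single p q t (x - y i) (ξ i) = (∏ i, (1 - ξ i))⁻¹ *
      (∏ i, (ξ i ^ (x - y i - 1) * Complex.exp (eps p q (ξ i) * t))) * ∏ i, ξ i := by
    rw [← Finset.prod_inv_distrib, ← Finset.prod_mul_distrib, ← Finset.prod_mul_distrib]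
    refine Finset.prod_congr rfl fun i _ => ?_
    have h0 := hξ i
    rw [zpow_sub_one₀ h0]
    unfold single
    field_simp
  unfold wave integrand
  rw [h1, h2, h3]
  ring

theorem wave_comp_map {ι κ : Type*} [LinearOrder ι] [LinearOrder κ] (e : κ ↪o ι) (p q t : ℝ)
    (x : ℤ) (Y : ι → ℤ) (S : Finset κ) (ξ : ι → ℂ) :
    wave p q t x (Y ∘ e) S (ξ ∘ e) = wave p q t x Y (S.map e.toEmbedding) ξ := by
  unfold wave
  rw [Finset.prod_map]
  congr 1
  have : incPairs (S.map e.toEmbedding) =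
      (incPairs S).map (e.toEmbedding.prodMap e.toEmbedding) := by
    ext ⟨a, b⟩
    simp only [mem_incPairs, Finset.mem_map, Prod.exists]
    constructor
    · rintro ⟨⟨⟨c, hc, rfl⟩, d, hd, rfl⟩, hlt⟩
      exact ⟨c, d, ⟨⟨hc, hd⟩, e.lt_iff_lt.1 hlt⟩, rfl⟩
    · rintro ⟨c, d, ⟨⟨hc, hd⟩, hlt⟩, h⟩
      obtain ⟨rfl, rfl⟩ := Prod.mk.inj h
      exact ⟨⟨⟨c, hc, rfl⟩, d, hd, rfl⟩, e.lt_iff_lt.2 hlt⟩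
  rw [this, Finset.prod_map]
  rfl

theorem IsLarge.waveIntegral_comp_map {ι κ : Type*} [LinearOrder ι] [LinearOrder κ] [Fintype ι]
    [Fintype κ] (hR : IsLarge p q R) (e : κ ↪o ι) (t : ℝ) (x : ℤ) (Y : ι → ℤ) (S : Finset κ) :
    waveIntegral p q t x R (Y ∘ e) S = waveIntegral p q t x R Y (S.map e.toEmbedding) := by
  unfold waveIntegral
  rw [← integral_torusMeasure_comp hR.pos.le e.injective (hR.continuousOn_wave t x (Y ∘ e) S)]
  simp only [wave_comp_map]

/-- The embedding of the indices counted from `0` into the indices counted from `1`. -/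
def succEmb (N : ℕ) : Fin N ↪o ℕ :=
  OrderEmbedding.ofStrictMono (fun i => (i : ℕ) + 1) fun _ _ h => Nat.succ_lt_succ h

@[simp] theorem succEmb_apply {N : ℕ} (i : Fin N) : succEmb N i = i + 1 := rfl

theorem coeff_map_succEmb {N : ℕ} (hq : q ≠ 0) (T : Finset (Fin N)) :
    coeff p q (T.map (succEmb N).toEmbedding) = weight p q T := by
  have h1 : (∑ i ∈ T.map (succEmb N).toEmbedding, (i : ℤ)) = ((∑ i ∈ T, ((i : ℕ) + 1) : ℕ) : ℤ) := by
    rw [Finset.sum_map]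
    push_cast
    rfl
  have h2 : (∑ i ∈ T, ((i : ℕ) + 1) : ℕ) = ∑ i ∈ T, (i : ℕ) + T.card := by
    rw [Finset.sum_add_distrib]; simp
  have h3 : (T.card : ℤ) * ((T.card : ℤ) + 1) / 2 = ((T.card + 1).choose 2 : ℕ) := by
    rw [Nat.choose_two_right, Nat.add_sub_cancel, mul_comm (T.card + 1)]
    push_cast
    rfl
  unfold coeff weight
  rw [Finset.card_map, h1, h3, zpow_sub₀ hq, zpow_natCast, zpow_natCast,
    show ((∑ i ∈ T, ((i : ℕ) + 1) : ℕ) : ℤ) - (T.card : ℤ) = ((∑ i ∈ T, (i : ℕ) : ℕ) : ℤ) by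
      rw [h2]; push_cast; ring, zpow_natCast, Finset.prod_mul_distrib, Finset.prod_pow_eq_pow_sum,
    Finset.prod_pow_eq_pow_sum, inv_pow]
  field_simp

theorem IsLarge.contribution_eq {N : ℕ} (hR : IsLarge p q R) (t : ℝ) (x : ℤ) (y : ℕ → ℤ)
    (T : Finset (Fin N)) :
    contribution p q t x y R (T.map (succEmb N).toEmbedding) =
      weight p q T * (waveIntegral p q t x R (y ∘ succEmb N) T -
        waveIntegral p q t (x + 1) R (y ∘ succEmb N) T) := by
  set S := T.map (succEmb N).toEmbedding with hS
  have hcard : T.card = S.card := (Finset.card_map _).symm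
  set e : Fin S.card ↪o Fin N := T.orderEmbOfFin hcard with he
  have hsub : subConfig y S = (y ∘ succEmb N) ∘ e := by
    have : (fun k => succEmb N (e k)) = S.orderEmbOfFin rfl :=
      Finset.orderEmbOfFin_unique rfl
        (fun k => Finset.mem_map_of_mem _ (T.orderEmbOfFin_mem hcard k))
        ((succEmb N).strictMono.comp e.strictMono)
    ext k
    rw [subConfig, ← this]
    rfl
  have hmap : (Finset.univ : Finset (Fin S.card)).map e.toEmbedding = T :=
    Finset.map_orderEmbOfFin_univ T hcard
  have hint := fun x => hR.integrable_wave t x (subConfig y S) Finset.univ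
  have hw : ∀ x, ∫ ξ, wave p q t x (subConfig y S) Finset.univ ξ ∂torusMeasure (fun _ => R) =
      waveIntegral p q t x R (y ∘ succEmb N) T := by
    intro x
    conv_rhs => rw [← hmap]
    rw [← hR.waveIntegral_comp_map, hsub]
    rfl
  unfold contribution
  rw [coeff_map_succEmb hR.q_pos.ne', contourIntegral_eq_integral hR.pos.le
    ((holOutside_integrand (hR.polesInside _) t x _).continuousOn fun _ => le_rfl)]
  congr 1
  rw [← hw, ← hw, ← integral_sub (hint _) (hint _)]
  refine integral_congr_ae ((ae_torusMeasure fun _ => hR.pos.le).mono fun ξ hξ => ?_)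
  exact integrand_mul_prod_eq t x _ fun i => hR.ne_zero (hξ i).ge

theorem integrand_eq_zero_of_eq_zero {n : ℕ} (hn : n = 0) (t : ℝ) (x : ℤ) (y : Fin n → ℤ) :
    integrand p q t x y = 0 := by
  subst hn
  ext ξ
  simp [integrand]

theorem contribution_empty (p q t : ℝ) (x : ℤ) (y : ℕ → ℤ) (R : ℝ) :
    contribution p q t x y R ∅ = 0 := by
  rw [contribution, integrand_eq_zero_of_eq_zero Finset.card_empty, contourIntegral, torusIntegral]
  simp only [Pi.zero_apply, smul_zero, integral_zero, mul_zero]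

theorem exists_map_succEmb {N : ℕ} {S : Finset ℕ} (hS : S ⊆ Finset.Icc 1 N) :
    ∃ T : Finset (Fin N), T.map (succEmb N).toEmbedding = S := by
  refine ⟨Finset.univ.filter fun i => (i : ℕ) + 1 ∈ S, ?_⟩
  ext k
  simp only [Finset.mem_map, Finset.mem_filter, Finset.mem_univ, true_and, RelEmbedding.coe_toEmbedding,
    succEmb_apply]
  constructor
  · rintro ⟨i, hi, rfl⟩; exact hi
  · intro hk
    have := Finset.mem_Icc.1 (hS hk)
    exact ⟨⟨k - 1, by omega⟩, by simpa [Nat.sub_add_cancel this.1] using hk,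
      Nat.sub_add_cancel this.1⟩

theorem map_succEmb_subset {N : ℕ} (T : Finset (Fin N)) :
    T.map (succEmb N).toEmbedding ⊆ Finset.Icc 1 N := by
  intro k hk
  obtain ⟨i, _, rfl⟩ := Finset.mem_map.1 hk
  simp only [RelEmbedding.coe_toEmbedding, succEmb_apply, Finset.mem_Icc]
  omega

theorem IsLarge.probFirst_eq_sum {N : ℕ} (hR : IsLarge p q R) (hN : 0 < N) {t : ℝ} (ht : 0 ≤ t)
    (x : ℤ) (y : ℕ → ℤ) (hy : StrictMonoOn y (Icc 1 N)) :
    (probFirst hN p q t (initialConfig y N hy) x : ℂ) =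
      ∑ S ∈ (Finset.Icc 1 N).powerset with S.Nonempty, contribution p q t x y R S := by
  rw [hR.probFirst_eq hN ht, tailFormula, tailFormula, ← Finset.sum_sub_distrib,
    Finset.sum_filter_of_ne (p := Finset.Nonempty)]
  · refine Finset.sum_bij (fun T _ => T.map (succEmb N).toEmbedding)
      (fun T _ => Finset.mem_powerset.2 (map_succEmb_subset T))
      (fun _ _ _ _ h => Finset.map_injective _ h) (fun S hS => ?_) fun T _ => ?_
    · obtain ⟨T, hT⟩ := exists_map_succEmb (Finset.mem_powerset.1 hS)
      exact ⟨T, Finset.mem_univ _, hT⟩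
    · rw [hR.contribution_eq, mul_sub]
      rfl
  · intro S _ hS
    rw [Finset.nonempty_iff_ne_empty]
    rintro rfl
    exact hS (contribution_empty _ _ _ _ _ _)

theorem exists_isLarge_ge (hp : 0 ≤ p) (hq : 0 ≤ q) (hpq : p + q = 1) (hq0 : q ≠ 0) (R : ℝ) :
    ∃ R', R ≤ R' ∧ IsLarge p q R' := by
  have hq' : 0 < q := lt_of_le_of_ne hq hq0.symm
  refine ⟨max R (4 / q), le_max_left _ _, hp, hq', hpq, ?_⟩
  calc 4 = q * (4 / q) := by field_simp
    _ ≤ _ := mul_le_mul_of_nonneg_left (le_max_right _ _) hq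

/-- The formula for finitely many particles. -/
theorem probFirst_eq_sum_contribution (hp : 0 ≤ p) (hq : 0 ≤ q) (hpq : p + q = 1) (hq0 : q ≠ 0)
    {t : ℝ} (ht : 0 ≤ t) (x : ℤ) {N : ℕ} (hN : 0 < N) (y : ℕ → ℤ)
    (hy : StrictMonoOn y (Icc 1 N)) (h : PolesInside p q R N) :
    (probFirst hN p q t (initialConfig y N hy) x : ℂ) =
      ∑ S ∈ (Finset.Icc 1 N).powerset with S.Nonempty, contribution p q t x y R S := by
  obtain ⟨R', hRR', hR'⟩ := exists_isLarge_ge hp hq hpq hq0 R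
  have hR := h.one_lt hN
  rw [hR'.probFirst_eq_sum hN ht x y hy]
  refine Finset.sum_congr rfl fun S hS => contribution_eq_of_le hR hRR' (h.mono ?_) t x y
  have := Finset.card_le_card (Finset.mem_powerset.1 (Finset.mem_filter.1 hS).1)
  simpa using this

theorem IsLarge.weight_le {N : ℕ} (hR : IsLarge p q R) (T : Finset (Fin N)) :
    |weight p q T| ≤ ∏ i ∈ T, q⁻¹ ^ ((i : ℕ) + 1) := by
  have hq := hR.q_pos
  have hp := hR.p_nonneg
  have hp1 : p ≤ 1 := by linarith [hR.add_eq]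
  have h0 : ∀ i : Fin N, 0 ≤ p ^ (i : ℕ) * q⁻¹ ^ ((i : ℕ) + 1) := fun i => by positivity
  unfold weight
  rw [abs_of_nonneg (mul_nonneg (Finset.prod_nonneg fun i _ => h0 i) (by positivity))]
  refine (mul_le_of_le_one_right (Finset.prod_nonneg fun i _ => h0 i)
    (pow_le_one₀ hq.le hR.q_le_one)).trans (Finset.prod_le_prod (fun i _ => h0 i) fun i _ => ?_)
  exact mul_le_of_le_one_left (by positivity) (pow_le_one₀ hp hp1)

theorem add_le_of_strictMonoOn {y : ℕ → ℤ} (hy : StrictMonoOn y (Ici 1)) (k : ℕ) :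
    y 1 + k ≤ y (k + 1) := by
  induction k with
  | zero => simp
  | succ k ih =>
    have := hy (a := k + 1) (b := k + 1 + 1) (by simp) (by simp) (by omega)
    push_cast
    omega

theorem IsLarge.norm_contribution_le (hR : IsLarge p q R) {t : ℝ} (ht : 0 ≤ t) (x : ℤ) {y : ℕ → ℤ}
    (hy : StrictMonoOn y (Ici 1)) {S : Finset ℕ} (hS : ∀ i ∈ S, 1 ≤ i) :
    ‖contribution p q t x y R S‖ ≤
      2 * ∏ k ∈ S, (Real.exp ((R + 2) * t) * R ^ (x + 1 - y 1) * R * (q * R)⁻¹ ^ k) := by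
  have hq := hR.q_pos
  have hR0 := hR.pos
  have hR1 : 1 ≤ R := by linarith [hR.four_le]
  obtain ⟨N, hsub⟩ : ∃ N, S ⊆ Finset.Icc 1 N := ⟨S.sup id, fun k hk =>
    Finset.mem_Icc.2 ⟨hS k hk, Finset.le_sup (f := id) hk⟩⟩
  obtain ⟨T, rfl⟩ := exists_map_succEmb hsub
  have hE : 0 < Real.exp ((R + 2) * t) := Real.exp_pos _
  set B := ∏ i ∈ T, (Real.exp ((R + 2) * t) * R ^ (x + 1 - y (i + 1))) with hB
  have h1 : ‖waveIntegral p q t x R (y ∘ succEmb N) T‖ ≤ B :=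
    (hR.norm_waveIntegral_le ht x _ T).trans <|
      Finset.prod_le_prod (fun i _ => by positivity) fun i _ =>
        mul_le_mul_of_nonneg_left (zpow_le_zpow_right₀ hR1 (by simp)) hE.le
  have h2 : ‖waveIntegral p q t (x + 1) R (y ∘ succEmb N) T‖ ≤ B :=
    hR.norm_waveIntegral_le ht (x + 1) _ T
  rw [hR.contribution_eq, norm_mul, Complex.norm_real, Real.norm_eq_abs]
  calc _ ≤ (∏ i ∈ T, q⁻¹ ^ ((i : ℕ) + 1)) * (2 * B) :=
        mul_le_mul (hR.weight_le T) ((norm_sub_le _ _).trans (by linarith)) (norm_nonneg _)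
          (Finset.prod_nonneg fun _ _ => by positivity)
    _ = 2 * ∏ i ∈ T, (q⁻¹ ^ ((i : ℕ) + 1) *
          (Real.exp ((R + 2) * t) * R ^ (x + 1 - y (i + 1)))) := by
        rw [Finset.prod_mul_distrib, hB]; ring
    _ ≤ _ := by
        rw [Finset.prod_map]
        refine mul_le_mul_of_nonneg_left (Finset.prod_le_prod (fun _ _ => by positivity)
          fun i _ => ?_) zero_le_two
        have h3 : R ^ (x + 1 - y (i + 1)) ≤ R ^ (x + 1 - y 1) * R * R⁻¹ ^ ((i : ℕ) + 1) := by
          calc R ^ (x + 1 - y (i + 1)) ≤ R ^ (x + 1 - y 1 + 1 - ((i : ℕ) + 1 : ℕ)) := by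
                refine zpow_le_zpow_right₀ hR1 ?_
                have := add_le_of_strictMonoOn hy i
                push_cast
                omega
            _ = _ := by
                rw [zpow_sub₀ hR0.ne', zpow_add_one₀ hR0.ne', zpow_natCast, inv_pow,
                  div_eq_mul_inv]
        calc q⁻¹ ^ ((i : ℕ) + 1) * (Real.exp ((R + 2) * t) * R ^ (x + 1 - y (i + 1)))
            ≤ q⁻¹ ^ ((i : ℕ) + 1) * (Real.exp ((R + 2) * t) *
              (R ^ (x + 1 - y 1) * R * R⁻¹ ^ ((i : ℕ) + 1))) := by gcongr
          _ = _ := by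
              simp only [RelEmbedding.coe_toEmbedding, succEmb_apply, mul_inv, mul_pow]
              ring

/-- Absolute convergence of the series for infinitely many particles. -/
theorem summable_contribution (hp : 0 ≤ p) (hq : 0 ≤ q) (hpq : p + q = 1) (hq0 : q ≠ 0)
    {t : ℝ} (ht : 0 ≤ t) (x : ℤ) {y : ℕ → ℤ} (hy : StrictMonoOn y (Ici 1))
    (h : ∀ n, PolesInside p q R n) :
    Summable fun S : {S : Finset ℕ // S.Nonempty ∧ ∀ i ∈ S, 1 ≤ i} =>
      contribution p q t x y R S := by
  obtain ⟨R', hRR', hR'⟩ := exists_isLarge_ge hp hq hpq hq0 R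
  have hq' := hR'.q_pos
  have hR0 := hR'.pos
  have hgeo : Summable fun k : ℕ =>
      Real.exp ((R' + 2) * t) * R' ^ (x + 1 - y 1) * R' * (q * R')⁻¹ ^ k :=
    (summable_geometric_of_lt_one (by positivity)
      (inv_lt_one_of_one_lt₀ (by linarith [hR'.large]))).mul_left _
  have hs := ((summable_finsetProd_of_summable_nonneg (fun k => by positivity) hgeo).mul_left
    2).comp_injective (Subtype.val_injective
      (p := fun S : Finset ℕ => S.Nonempty ∧ ∀ i ∈ S, 1 ≤ i))
  refine Summable.of_norm_bounded hs fun S => ?_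
  rw [← contribution_eq_of_le ((h 1).one_lt one_pos) hRR' (h _) t x y]
  exact hR'.norm_contribution_le ht x hy S.2.2

theorem tendsto_subtype_powerset_Icc : Filter.Tendsto
    (fun n : ℕ => (Finset.Icc 1 (n + 1)).powerset.subtype
      fun S : Finset ℕ => S.Nonempty ∧ ∀ i ∈ S, 1 ≤ i) Filter.atTop Filter.atTop := by
  refine Filter.tendsto_atTop_finset_of_monotone (fun n m hnm S hS => ?_) fun S => ?_
  · rw [Finset.mem_subtype, Finset.mem_powerset] at hS ⊢
    exact hS.trans (Finset.Icc_subset_Icc_right (by omega))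
  · refine ⟨S.1.sup id, ?_⟩
    rw [Finset.mem_subtype, Finset.mem_powerset]
    exact fun k hk => Finset.mem_Icc.2
      ⟨S.2.2 k hk, (Finset.le_sup (f := id) hk).trans (Nat.le_succ _)⟩

theorem sum_subtype_powerset_Icc {M : Type*} [AddCommMonoid M] (f : Finset ℕ → M) (N : ℕ) :
    ∑ S ∈ (Finset.Icc 1 N).powerset.subtype
      (fun S : Finset ℕ => S.Nonempty ∧ ∀ i ∈ S, 1 ≤ i), f S =
      ∑ S ∈ (Finset.Icc 1 N).powerset with S.Nonempty, f S := by
  rw [Finset.sum_subtype_eq_sum_filter]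
  congr 1
  ext S
  simp only [Finset.mem_filter, Finset.mem_powerset]
  exact ⟨fun h => ⟨h.1, h.2.1⟩, fun h => ⟨h.1, h.2, fun i hi => (Finset.mem_Icc.1 (h.1 hi)).1⟩⟩

end

end ASEP

end

theorem theorem3p2 (p q : ℝ) (hp : 0 ≤ p) (hq : 0 ≤ q) (hpq : p + q = 1) (hq0 : q ≠ 0)
    (t : ℝ) (ht : 0 ≤ t) (x : ℤ) :
    -- the `N`-particle system
    (∀ (N : ℕ) (hN : 0 < N) (y : ℕ → ℤ) (hy : StrictMonoOn y (Set.Icc 1 N))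
      (R : ℝ), ASEP.PolesInside p q R N →
        (ASEP.probFirst hN p q t (ASEP.initialConfig y N hy) x : ℂ) =
          ∑ S ∈ (Finset.Icc 1 N).powerset with S.Nonempty, ASEP.contribution p q t x y R S) ∧
    -- infinite initial configurations
    (∀ (y : ℕ → ℤ) (hy : StrictMonoOn y (Set.Ici 1))
      (R : ℝ), (∀ n, ASEP.PolesInside p q R n) →
        Summable (fun S : {S : Finset ℕ // S.Nonempty ∧ ∀ i ∈ S, 1 ≤ i} =>
          ASEP.contribution p q t x y R S) ∧
        Filter.Tendsto
          (fun n : ℕ => (ASEP.probFirst (Nat.succ_pos n) p q t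
            (ASEP.initialConfig y (n + 1) (hy.mono fun _ h => h.1)) x : ℂ))
          Filter.atTop
          (nhds (∑' S : {S : Finset ℕ // S.Nonempty ∧ ∀ i ∈ S, 1 ≤ i},
            ASEP.contribution p q t x y R S))) := by
  refine ⟨fun N hN y hy R h =>
    ASEP.probFirst_eq_sum_contribution hp hq hpq hq0 ht x hN y hy h, fun y hy R h => ?_⟩
  have hs := ASEP.summable_contribution hp hq hpq hq0 ht x hy h
  refine ⟨hs, (hs.hasSum.comp ASEP.tendsto_subtype_powerset_Icc).congr fun n => ?_⟩
  rw [ASEP.probFirst_eq_sum_contribution hp hq hpq hq0 ht x (Nat.succ_pos n) y _ (h (n + 1))]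
  exact ASEP.sum_subtype_powerset_Icc _ _
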